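/- **Setting.** Let $\mathbb F_\epsilon$ be a finite field with $\hat q$ elements, $A_\epsilon=\mathbb F_\epsilon[[z]]$ and $Q_\epsilon=\mathbb F_\epsilon((z))$. Let $K$ be a field which is complete with respect to a non-trivial non-archimedean absolute value $|\cdot|\colon K\to\mathbb R_{\ge0}$, let $R=\{x\in K:|x|\le 1\}$, and let $\gamma\colon A_\epsilon\hookrightarrow R$ be an injective ring homomorphism such that $\zeta:=\gamma(z)$ satisfies $|\zeta|<1$. Via $\gamma|_{\mathbb F_\epsilon}$ on coefficients and $z\mapsto z$ we view $A_\epsilon$ as a subring of $R[[z]]$. Let $K^{\rm sep}$ be a separable closure of $K$, equipped with the unique extension of $|\cdot|$, and $G=\mathrm{Gal}(K^{\rm sep}/K)$. Let $\hat\sigma$ be the endomorphism of $R[[z]]$, of $K^{\rm sep}[[z]]$ and of $K^{\rm sep}((z))$ with $\hat\sigma(z)=z$ and $\hat\sigma(b)=b^{\hat q}$ on coefficients $b$; the group $G$ acts on $K^{\rm sep}[[z]]$ and $K^{\rm sep}((z))$ through the coefficients. For real $s>0$ put $$K^{\rm sep}\langle\tfrac{z}{\zeta^s}\rangle=\Bigl\{\sum_{i\ge0}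 b_iz^i\in K^{\rm sep}[[z]] : |b_i||\zeta|^{si}\to0\Bigr\},$$ so that $\hat\sigma$ restricts to $K^{\rm sep}\langle\frac{z}{\zeta^s}\rangle\to K^{\rm sep}\langle\frac{z}{\zeta^{s\hat q}}\rangle$. A *local shtuka* over $R$ is a pair $\underline{\hat M}=(\hat M,\tau_{\hat M})$ of a finite free $R[[z]]$-module $\hat M$ and an isomorphism $\tau_{\hat M}\colon(\hat\sigma^*\hat M)[\frac1{z-\zeta}]\to\hat M[\frac1{z-\zeta}]$ of $R[[z]][\frac1{z-\zeta}]$-modules, where $\hat\sigma^*\hat M=\hat M\otimes_{R[[z]],\hat\sigma}R[[z]]$; its rank is that of $\hat M$. A morphism is an $R[[z]]$-linear map $f$ with $\tau_{\hat M'}\circ\hat\sigma^*f=f\circ\tau_{\hat M}$. Write $\hat\sigma^*_{\hat M}m=m\otimes1$. Since $z-\zeta$ is a unit in $K^{\rm sep}[[z]]$ and in $K^{\rm sep}((z))$, $\hat M\otimes_{R[[z]]}K^{\rm sep}[[z]]$ and $\hat M\otimes_{R[[z]]}K^{\rm sep}((z))$ carry the $\hat\sigma$-semilinear map $\hat\tau=(\tau_{\hat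 M}\circ\hat\sigma^*_{\hat M})\otimes\hat\sigma$. The Tate module $\check T_\epsilon\underline{\hat M}$ (an $A_\epsilon$-module) and the rational Tate module $\check V_\epsilon\underline{\hat M}$ (a $Q_\epsilon$-vector space) are the respective sets of $\hat\tau$-invariants, on which $G$ acts through the second tensor factor. **Theorem.** Let $\underline{\hat M}$ be a local shtuka of rank $r$ over $R$. 1. $\check T_\epsilon\underline{\hat M}$ is a free $A_\epsilon$-module of rank $r$ and $\check V_\epsilon\underline{\hat M}$ is a $Q_\epsilon$-vector space of dimension $r$. The actions of $G$ on both are continuous (for $\check T_\epsilon\underline{\hat M}$: for every $n$ the subgroup of $G$ acting trivially modulo $z^n$ is open; for $\check V_\epsilon\underline{\hat M}$: the action map $G\times\check V_\epsilon\underline{\hat M}\to\check V_\epsilon\underline{\hat M}$ is continuous for the $z$-adic topology). 2. The inclusion $\check T_\epsilon\underline{\hat M}\subset\hat M\otimes_{R[[z]]}K^{\rm sep}[[z]]$ induces an isomorphism of $K^{\rm sep}[[z]]$-modules $$\check T_\epsilon\underline{\hat M}\otimes_{A_\epsilon}K^{\rm sep}[[z]]\;\xrightarrow{\ \sim\ }\;\hat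 M\otimes_{R[[z]]}K^{\rm sep}[[z]],$$ which is functorial in $\underline{\hat M}$ and equivariant for $G$ and $\hat\tau$; here on the left $G$ acts on both factors and $\hat\tau=\mathrm{id}\otimes\hat\sigma$, and on the right $G$ acts only on $K^{\rm sep}[[z]]$. Moreover $\hat M\otimes_{R[[z]]}K[[z]]\to\hat M\otimes_{R[[z]]}K^{\rm sep}[[z]]$ is injective, and the above isomorphism identifies the $G$-invariants of $\check T_\epsilon\underline{\hat M}\otimes_{A_\epsilon}K^{\rm sep}[[z]]$ with $\hat M\otimes_{R[[z]]}K[[z]]$. 3. There are isomorphisms, for every real $s>1/\hat q$, $$h_s\colon\check T_\epsilon\underline{\hat M}\otimes_{A_\epsilon}K^{\rm sep}\langle\tfrac{z}{\zeta^s}\rangle\;\xrightarrow{\ \sim\ }\;\hat M\otimes_{R[[z]]}K^{\rm sep}\langle\tfrac{z}{\zeta^s}\rangle$$ of $K^{\rm sep}\langle\frac z{\zeta^s}\rangle$-modules, functorial in $\underline{\hat M}$ and $G$-equivariant, compatible with the isomorphism in 2 and with the inclusions $K^{\rm sep}\langle\frac z{\zeta^s}\rangle\subset K^{\rm sep}\langle\frac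 z{\zeta^t}\rangle$ for $s\le t$. They are $\hat\tau$-equivariant in the sense that $h_{s\hat q}\circ(\mathrm{id}\otimes\hat\sigma)=\bigl((\tau_{\hat M}\circ\hat\sigma^*_{\hat M})\otimes\hat\sigma\bigr)\circ h_s$ as maps $\check T_\epsilon\underline{\hat M}\otimes_{A_\epsilon}K^{\rm sep}\langle\frac z{\zeta^s}\rangle\to\hat M\otimes_{R[[z]]}K^{\rm sep}\langle\frac z{\zeta^{s\hat q}}\rangle$. -/

import Mathlib

open PowerSeries LaurentSeries Filter Topology

universe u v w x

noncomputable section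

/-! ## Base change along a ring homomorphism -/

/-- The base change `M ⊗_{A,f} B` of an `A`-module `M` along a ring homomorphism `f : A → B`. -/
def BaseChange {A B : Type*} [CommRing A] [CommRing B] (f : A →+* B)
    (M : Type*) [AddCommGroup M] [Module A M] : Type _ :=
  @TensorProduct A _ B M _ _ f.toAlgebra.toModule _

namespace BaseChange

section

variable {A B C : Type*} [CommRing A] [CommRing B] [CommRing C] (f : A →+* B)
  {M N : Type*} [AddCommGroup M] [Module A M] [AddCommGroup N]

instance : AddCommGroup (BaseChange f M) :=
  @TensorProduct.addCommGroup A _ B M _ _ f.toAlgebra.toModule _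

instance : Module B (BaseChange f M) :=
  letI := f.toAlgebra
  (TensorProduct.leftModule : Module B (TensorProduct A B M))

/-- The canonical map `m ↦ m ⊗ 1`. -/
def of : M →ₛₗ[f] BaseChange f M where
  toFun m := letI := f.toAlgebra; (1 : B) ⊗ₜ[A] m
  map_add' := fun _ _ => letI := f.toAlgebra; TensorProduct.tmul_add _ _ _
  map_smul' := fun a m => by
    let _ := f.toAlgebra
    change (1 : B) ⊗ₜ[A] (a • m) = (f a • ((1 : B) ⊗ₜ[A] m) : TensorProduct A B M)
    rw [TensorProduct.smul_tmul', ← TensorProduct.smul_tmul, Algebra.smul_def]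
    rfl

theorem induction {p : BaseChange f M → Prop} (h0 : p 0)
    (hof : ∀ (b : B) (m : M), p (b • of f m)) (hadd : ∀ x y, p x → p y → p (x + y))
    (x : BaseChange f M) : p x := by
  let _ := f.toAlgebra
  refine TensorProduct.induction_on (R := A) (M := B) (N := M) (motive := p) x h0
    (fun b m => ?_) (fun x y => hadd x y)
  have h := hof b m
  have e : b • of f m = (b ⊗ₜ[A] m : TensorProduct A B M) := by
    change (b • ((1 : B) ⊗ₜ[A] m) : TensorProduct A B M) = _
    rw [TensorProduct.smul_tmul']; simp
  rwa [e] at h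

/-- The map `M ⊗_{A,f} B → N`, `m ⊗ b ↦ g(b) • φ(m)`, which is semilinear over `g : B → C`, for a
`C`-module `N` and a map `φ : M → N` which is semilinear over `h = g ∘ f`. -/
def lift [Module C N] (g : B →+* C) (h : A →+* C) (hc : ∀ a, g (f a) = h a) (φ : M →ₛₗ[h] N) :
    BaseChange f M →ₛₗ[g] N :=
  letI := f.toAlgebra
  let l : TensorProduct A B M →+ N := TensorProduct.liftAddHom
    { toFun := fun b => AddMonoidHom.comp (DistribSMul.toAddMonoidHom N (g b)) φ.toAddMonoidHom
      map_zero' := by ext; simp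
      map_add' := fun _ _ => by ext; simp [add_smul] }
    (fun a b m => by
      have e : a • b = f a * b := Algebra.smul_def a b
      change g (a • b) • φ m = g b • φ (a • m)
      rw [e, map_mul, hc, LinearMap.map_smulₛₗ, smul_smul, mul_comm])
  { toFun := l
    map_add' := l.map_add
    map_smul' := fun b x => by
      refine TensorProduct.induction_on (R := A) (M := B) (N := M)
        (motive := fun x => l (b • x) = g b • l x) x ?_ (fun c m => ?_) (fun x y hx hy => ?_)
      · simp
      · rw [TensorProduct.smul_tmul']
        change g (b * c) • φ m = g b • (g c • φ m)
        rw [map_mul, mul_smul]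
      · simp only [smul_add, map_add, hx, hy] }

@[simp] theorem lift_smul_of [Module C N] (g : B →+* C) (h : A →+* C) (hc : ∀ a, g (f a) = h a)
    (φ : M →ₛₗ[h] N) (b : B) (m : M) : lift f g h hc φ (b • of f m) = g b • φ m := by
  let _ := f.toAlgebra
  rw [LinearMap.map_smulₛₗ]
  congr 1
  change g 1 • φ m = φ m
  simp

end

section

variable {A B C : Type*} [CommRing A] [CommRing B] [CommRing C]
  {M N : Type*} [AddCommGroup M] [Module A M] [AddCommGroup N] [Module A N]

/-- The map `M ⊗_{A,f} B → N ⊗_{A,f'} C`, `m ⊗ b ↦ u(m) ⊗ g(b)`, for `g : B → C` with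
`g ∘ f = f'` and an `A`-linear map `u : M → N`. -/
def map (f : A →+* B) (f' : A →+* C) (g : B →+* C) (hc : ∀ a, g (f a) = f' a) (u : M →ₗ[A] N) :
    BaseChange f M →ₛₗ[g] BaseChange f' N :=
  lift f g f' hc
    { toFun := fun m => of f' (u m)
      map_add' := fun _ _ => by simp
      map_smul' := fun a m => by rw [map_smul, LinearMap.map_smulₛₗ] }

@[simp] theorem map_smul_of (f : A →+* B) (f' : A →+* C) (g : B →+* C) (hc : ∀ a, g (f a) = f' a)
    (u : M →ₗ[A] N) (b : B) (m : M) :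
    map f f' g hc u (b • of f m) = g b • of f' (u m) :=
  lift_smul_of f g f' hc _ b m

theorem map_id (f : A →+* B) (u : M →ₗ[A] M) (hu : ∀ m, u m = m) (x : BaseChange f M) :
    map f f (RingHom.id B) (fun _ => rfl) u x = x := by
  induction x using BaseChange.induction with
  | h0 => exact map_zero _
  | hof b m => rw [map_smul_of, hu, RingHom.id_apply]
  | hadd x y hx hy => rw [map_add, hx, hy]

end

end BaseChange

/-! ## Coefficient rings -/

/-- The valuation ring `R = {x ∈ K : |x| ≤ 1}` of an ultrametric normed field `K`. -/
abbrev intRing (K : Type v) [NontriviallyNormedField K] [IsUltrametricDist K] :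
    ValuationSubring K :=
  (NormedField.valuation (K := K)).valuationSubring

/-- The endomorphism `b ↦ b ^ q̂`, `q̂ = #F`, of a ring `B` receiving a homomorphism from the finite
field `F`. -/
def qFrob {F B : Type*} [Field F] [Finite F] [CommRing B] (i : F →+* B) : B →+* B where
  toFun b := b ^ Nat.card F
  map_one' := one_pow _
  map_mul' a b := mul_pow a b _
  map_zero' := zero_pow Nat.card_pos.ne'
  map_add' a b := by
    let _ := i.toAlgebra
    let _ := Fintype.ofFinite F
    simpa [Nat.card_eq_fintype_card] using map_add (FiniteField.frobeniusAlgHom F B) a b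

/-- The homomorphism `B((z)) → C((z))` extending the coefficientwise homomorphism
`B[[z]] → C[[z]]` induced by `f`, with `z ↦ z`. -/
def laurentMap {B C : Type*} [CommRing B] [CommRing C] (f : B →+* C) : B⸨X⸩ →+* C⸨X⸩ :=
  IsLocalization.map (M := Submonoid.powers (X : B⟦X⟧)) (T := Submonoid.powers (X : C⟦X⟧))
    C⸨X⸩ (PowerSeries.map f) (by
      rintro _ ⟨n, rfl⟩
      exact ⟨n, by simp⟩)

theorem laurentMap_algebraMap {B C : Type*} [CommRing B] [CommRing C] (f : B →+* C) (b : B⟦X⟧) :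
    laurentMap f (algebraMap B⟦X⟧ B⸨X⸩ b) = algebraMap C⟦X⟧ C⸨X⸩ (PowerSeries.map f b) :=
  IsLocalization.map_eq _ _

theorem laurentMap_laurentMap {B C D : Type*} [CommRing B] [CommRing C] [CommRing D]
    (f : B →+* C) (g : C →+* D) (h : B →+* D) (hc : ∀ b, g (f b) = h b) (b : B⸨X⸩) :
    laurentMap g (laurentMap f b) = laurentMap h b := by
  have e : (laurentMap g).comp (laurentMap f) = laurentMap h := by
    apply IsLocalization.ringHom_ext (Submonoid.powers (X : B⟦X⟧))
    ext1 b
    simp only [RingHom.comp_apply, laurentMap_algebraMap]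
    congr 1
    ext n
    simp [hc]
  exact congrArg (fun k => k b) e

theorem laurentMap_id {B : Type*} [CommRing B] (f : B →+* B) (hf : ∀ b, f b = b) (b : B⸨X⸩) :
    laurentMap f b = b := by
  have e : laurentMap f = RingHom.id _ := by
    apply IsLocalization.ringHom_ext (Submonoid.powers (X : B⟦X⟧))
    ext1 b
    simp only [RingHom.comp_apply, laurentMap_algebraMap, RingHom.id_apply]
    congr 1
    ext n
    simp [hf]
  rw [e]; rfl

/-! ## The characteristic map -/

/-- An injective ring homomorphism `γ : A_ε = F[[z]] → R` into the valuation ring `R` of `K` such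
that `ζ = γ(z)` lies in the maximal ideal of `R`. -/
structure CharMap (F : Type u) [Field F] (K : Type v) [NontriviallyNormedField K]
    [IsUltrametricDist K] where
  toRingHom : F⟦X⟧ →+* intRing K
  injective : Function.Injective toRingHom
  norm_lt_one : ‖(toRingHom X : K)‖ < 1

namespace CharMap

section

variable {F : Type u} [Field F] {K : Type v} [NontriviallyNormedField K] [IsUltrametricDist K]
  (γ : CharMap F K)

/-- The element `ζ = γ(z)` of `R`. -/
def zeta : intRing K := γ.toRingHom X

theorem norm_zeta_pos : 0 < ‖(γ.zeta : K)‖ := by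
  rw [norm_pos_iff]
  intro h
  have h1 : γ.zeta = 0 := Subtype.ext h
  exact PowerSeries.X_ne_zero (γ.injective (h1.trans (map_zero _).symm))

theorem norm_zeta_lt : ‖(γ.zeta : K)‖ < 1 := γ.norm_lt_one

theorem tendsto_zeta_rpow {s : ℝ} (hs : 0 < s) :
    Tendsto (fun i : ℕ => ‖(γ.zeta : K)‖ ^ (s * i)) atTop (𝓝 0) := by
  have h : ‖(γ.zeta : K)‖ ^ s < 1 := Real.rpow_lt_one (norm_nonneg _) γ.norm_zeta_lt hs
  refine (tendsto_pow_atTop_nhds_zero_of_lt_one (Real.rpow_nonneg (norm_nonneg _) s) h).congr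
    (fun i => ?_)
  rw [Real.rpow_mul (norm_nonneg _), Real.rpow_natCast]

/-- The restriction of `γ` to the constants. -/
def const : F →+* intRing K := γ.toRingHom.comp PowerSeries.C

/-- `R[[z]][1/(z - ζ)]`. -/
abbrev Loc : Type v := Localization.Away (X - PowerSeries.C γ.zeta : (intRing K)⟦X⟧)

/-- The canonical homomorphism `R[[z]] → R[[z]][1/(z - ζ)]`. -/
abbrev toLoc : (intRing K)⟦X⟧ →+* γ.Loc := algebraMap _ _

/-- The homomorphism `A_ε = F[[z]] → R[[z]]` which is `γ` on the coefficients and sends `z` to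
`z`. -/
def ofA : F⟦X⟧ →+* (intRing K)⟦X⟧ := PowerSeries.map γ.const

/-- The endomorphism `σ̂` of `R[[z]]` with `σ̂(z) = z` and `σ̂(b) = b ^ q̂` for `b ∈ R`. -/
def sigma [Finite F] : (intRing K)⟦X⟧ →+* (intRing K)⟦X⟧ := PowerSeries.map (qFrob γ.const)

theorem sigma_ofA [Finite F] (a : F⟦X⟧) : γ.sigma (γ.ofA a) = γ.ofA a := by
  let _ := Fintype.ofFinite F
  ext n
  simp only [sigma, ofA, coeff_map, qFrob, RingHom.coe_mk, MonoidHom.coe_mk, OneHom.coe_mk,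
    ← map_pow, Nat.card_eq_fintype_card, FiniteField.pow_card]

end

section

variable {F : Type u} [Field F] {K : Type v} [NontriviallyNormedField K] [IsUltrametricDist K]
  (γ : CharMap F K) (L : Type x) [Field L] [Algebra K L]

/-- The inclusion `R → L` for a field extension `L` of `K`. -/
def intEmb : intRing K →+* L := (algebraMap K L).comp (intRing K).subtype

/-- The inclusion `F → R → L`. -/
def constExt : F →+* L := (intEmb L).comp γ.const

/-- The inclusion `R[[z]] → L[[z]]`. -/
def psEmb : (intRing K)⟦X⟧ →+* L⟦X⟧ := PowerSeries.map (intEmb L)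

/-- The inclusion `R[[z]] → L((z))`. -/
def lsEmb : (intRing K)⟦X⟧ →+* L⸨X⸩ := (algebraMap L⟦X⟧ L⸨X⸩).comp (psEmb L)

/-- The inclusion `A_ε → L[[z]]`. -/
def psA : F⟦X⟧ →+* L⟦X⟧ := (psEmb L).comp γ.ofA

/-- The inclusion `Q_ε = F((z)) → L((z))`. -/
def lsQ : F⸨X⸩ →+* L⸨X⸩ := laurentMap (γ.constExt L)

/-- The endomorphism `σ̂` of `L[[z]]`. -/
def psSigma [Finite F] : L⟦X⟧ →+* L⟦X⟧ := PowerSeries.map (qFrob (γ.constExt L))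

/-- The endomorphism `σ̂` of `L((z))`. -/
def lsSigma [Finite F] : L⸨X⸩ →+* L⸨X⸩ := laurentMap (qFrob (γ.constExt L))

/-- The action of a `K`-automorphism `g` of `L` on `L[[z]]` through the coefficients. -/
def psGal {L : Type x} [Field L] [Algebra K L] (g : L ≃ₐ[K] L) : L⟦X⟧ →+* L⟦X⟧ :=
  PowerSeries.map (g : L →+* L)

/-- The action of a `K`-automorphism `g` of `L` on `L((z))` through the coefficients. -/
def lsGal {L : Type x} [Field L] [Algebra K L] (g : L ≃ₐ[K] L) : L⸨X⸩ →+* L⸨X⸩ :=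
  laurentMap (g : L →+* L)

theorem psSigma_psEmb [Finite F] (a : (intRing K)⟦X⟧) :
    γ.psSigma L (psEmb L a) = psEmb L (γ.sigma a) := by
  ext n
  simp [psSigma, psEmb, sigma, qFrob]

theorem psSigma_psA [Finite F] (a : F⟦X⟧) : γ.psSigma L (γ.psA L a) = γ.psA L a := by
  simp only [psA, RingHom.comp_apply, psSigma_psEmb, sigma_ofA]

theorem lsSigma_lsEmb [Finite F] (a : (intRing K)⟦X⟧) :
    γ.lsSigma L (lsEmb L a) = lsEmb L (γ.sigma a) := by
  simp only [lsSigma, lsEmb, RingHom.comp_apply, laurentMap_algebraMap, ← psSigma_psEmb]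
  rfl

theorem lsSigma_lsQ [Finite F] (a : F⸨X⸩) : γ.lsSigma L (γ.lsQ L a) = γ.lsQ L a := by
  refine laurentMap_laurentMap _ _ _ (fun b => ?_) a
  let _ := Fintype.ofFinite F
  simp only [qFrob, RingHom.coe_mk, MonoidHom.coe_mk, OneHom.coe_mk, ← map_pow,
    Nat.card_eq_fintype_card, FiniteField.pow_card]

variable {L}

theorem psGal_psEmb (g : L ≃ₐ[K] L) (a : (intRing K)⟦X⟧) :
    psGal g (psEmb L a) = psEmb L a := by
  ext n
  simp [psGal, psEmb, intEmb]

theorem psGal_psA (g : L ≃ₐ[K] L) (a : F⟦X⟧) : psGal g (γ.psA L a) = γ.psA L a :=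
  psGal_psEmb g _

theorem lsGal_lsEmb (g : L ≃ₐ[K] L) (a : (intRing K)⟦X⟧) :
    lsGal g (lsEmb L a) = lsEmb L a := by
  simp only [lsGal, lsEmb, RingHom.comp_apply, laurentMap_algebraMap]
  exact congrArg _ (psGal_psEmb g a)

theorem lsGal_lsQ (g : L ≃ₐ[K] L) (a : F⸨X⸩) : lsGal g (γ.lsQ L a) = γ.lsQ L a :=
  laurentMap_laurentMap _ _ _ (fun b => by simp [constExt, intEmb]) a

theorem psSigma_psGal [Finite F] (g : L ≃ₐ[K] L) (a : L⟦X⟧) :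
    γ.psSigma L (psGal g a) = psGal g (γ.psSigma L a) := by
  ext n
  simp [psSigma, psGal, qFrob]

theorem lsSigma_lsGal [Finite F] (g : L ≃ₐ[K] L) (a : L⸨X⸩) :
    γ.lsSigma L (lsGal g a) = lsGal g (γ.lsSigma L a) := by
  refine (laurentMap_laurentMap _ _ ((qFrob (γ.constExt L)).comp (g : L →+* L))
    (fun _ => rfl) a).trans (laurentMap_laurentMap _ _ _ (fun b => ?_) a).symm
  simp [qFrob]

variable (L)

theorem isUnit_psEmb : IsUnit (psEmb L (X - PowerSeries.C γ.zeta)) := by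
  rw [PowerSeries.isUnit_iff_constantCoeff, isUnit_iff_ne_zero]
  have h := norm_pos_iff.mp γ.norm_zeta_pos
  simpa [psEmb, intEmb] using h

theorem isUnit_lsEmb : IsUnit (lsEmb L (X - PowerSeries.C γ.zeta)) :=
  (γ.isUnit_psEmb L).map (algebraMap L⟦X⟧ L⸨X⸩)

end

/-! ### Convergent power series -/

section

variable {F : Type u} [Field F] {K : Type v} [NontriviallyNormedField K] [IsUltrametricDist K]
  [CompleteSpace K] (γ : CharMap F K) (L : Type x) [Field L] [Algebra K L]
  [Algebra.IsAlgebraic K L]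

theorem tendsto_iff_isRestricted (s : ℝ) (f : L⟦X⟧) :
    letI := spectralNorm.normedField K L
    Tendsto (fun i : ℕ => spectralNorm K L (coeff i f) * ‖(γ.zeta : K)‖ ^ (s * i)) atTop (𝓝 0) ↔
      PowerSeries.IsRestricted (‖(γ.zeta : K)‖ ^ s) f := by
  let _ := spectralNorm.normedField K L
  rw [PowerSeries.isRestricted_iff']
  refine iff_of_eq ?_
  congr 1
  funext i
  rw [Real.rpow_mul (norm_nonneg _), Real.rpow_natCast]
  rfl

/-- The ring `L⟨z/ζ^s⟩` of power series `∑ bᵢ zⁱ` with coefficients in the algebraic extension `L`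
of `K` such that `|bᵢ| |ζ|^(s i) → 0`. Here `|·|` is the unique extension to `L` of the absolute
value of `K`, which is the spectral norm. -/
def conv (s : ℝ) : Subring L⟦X⟧ where
  carrier := {f | Tendsto
    (fun i : ℕ => spectralNorm K L (coeff i f) * ‖(γ.zeta : K)‖ ^ (s * i)) atTop (𝓝 0)}
  zero_mem' := (γ.tendsto_iff_isRestricted L s 0).2 (by
    let _ := spectralNorm.normedField K L
    exact PowerSeries.isRestricted_zero _)
  one_mem' := (γ.tendsto_iff_isRestricted L s 1).2 (by
    let _ := spectralNorm.normedField K L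
    exact PowerSeries.isRestricted_one _)
  add_mem' := fun {a b} ha hb => (γ.tendsto_iff_isRestricted L s (a + b)).2 (by
    let _ := spectralNorm.normedField K L
    exact PowerSeries.isRestricted.add _ ((γ.tendsto_iff_isRestricted L s a).1 ha)
      ((γ.tendsto_iff_isRestricted L s b).1 hb))
  neg_mem' := fun {a} ha => (γ.tendsto_iff_isRestricted L s (-a)).2 (by
    let _ := spectralNorm.normedField K L
    exact PowerSeries.isRestricted.neg _ ((γ.tendsto_iff_isRestricted L s a).1 ha))
  mul_mem' := fun {a b} ha hb => (γ.tendsto_iff_isRestricted L s (a * b)).2 (by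
    let _ := spectralNorm.normedField K L
    have : IsUltrametricDist L :=
      IsUltrametricDist.isUltrametricDist_of_isNonarchimedean_norm isNonarchimedean_spectralNorm
    exact PowerSeries.isRestricted.mul _ ((γ.tendsto_iff_isRestricted L s a).1 ha)
      ((γ.tendsto_iff_isRestricted L s b).1 hb))

variable {L} in
theorem mem_conv {s : ℝ} {f : L⟦X⟧} : f ∈ γ.conv L s ↔ Tendsto
    (fun i : ℕ => spectralNorm K L (coeff i f) * ‖(γ.zeta : K)‖ ^ (s * i)) atTop (𝓝 0) := Iff.rfl

theorem psEmb_mem_conv {s : ℝ} (hs : 0 < s) (a : (intRing K)⟦X⟧) : psEmb L a ∈ γ.conv L s := by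
  rw [mem_conv]
  refine squeeze_zero (fun i => mul_nonneg (spectralNorm_nonneg _)
    (Real.rpow_nonneg (norm_nonneg _) _)) (fun i => ?_) (γ.tendsto_zeta_rpow hs)
  refine mul_le_of_le_one_left (Real.rpow_nonneg (norm_nonneg _) _) ?_
  have h : spectralNorm K L (coeff i (psEmb L a)) = ‖((coeff i a : intRing K) : K)‖ := by
    simp only [psEmb, intEmb, coeff_map, RingHom.comp_apply]
    exact spectralNorm_extends _
  rw [h]
  exact (coeff i a).2

variable {L} in
theorem conv_mono {s t : ℝ} (hst : s ≤ t) {f : L⟦X⟧} (hf : f ∈ γ.conv L s) : f ∈ γ.conv L t := by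
  rw [mem_conv] at *
  refine squeeze_zero (fun i => mul_nonneg (spectralNorm_nonneg _)
    (Real.rpow_nonneg (norm_nonneg _) _)) (fun i => ?_) hf
  refine mul_le_mul_of_nonneg_left ?_ (spectralNorm_nonneg _)
  exact Real.rpow_le_rpow_of_exponent_ge γ.norm_zeta_pos γ.norm_zeta_lt.le
    (mul_le_mul_of_nonneg_right hst (Nat.cast_nonneg i))

variable {L} in
theorem psGal_mem_conv (g : L ≃ₐ[K] L) {s : ℝ} {f : L⟦X⟧} (hf : f ∈ γ.conv L s) :
    psGal g f ∈ γ.conv L s := by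
  rw [mem_conv] at *
  refine hf.congr (fun i => ?_)
  congr 1
  simpa [psGal] using spectralNorm_eq_of_equiv g (coeff i f)

variable {L} in
theorem psSigma_mem_conv [Finite F] {s : ℝ} {f : L⟦X⟧} (hf : f ∈ γ.conv L s) :
    γ.psSigma L f ∈ γ.conv L (s * Nat.card F) := by
  rw [mem_conv] at *
  have h := hf.pow (Nat.card F)
  rw [zero_pow Nat.card_pos.ne'] at h
  refine h.congr (fun i => ?_)
  rw [mul_pow, ← Real.rpow_natCast (‖(γ.zeta : K)‖ ^ (s * i)), ← Real.rpow_mul (norm_nonneg _)]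
  congr 1
  · simp only [psSigma, coeff_map, qFrob, RingHom.coe_mk, MonoidHom.coe_mk, OneHom.coe_mk]
    let _ := spectralNorm.normedField K L
    exact (norm_pow (coeff i f) (Nat.card F)).symm
  · congr 1; ring

theorem inv_mem_conv {s : ℝ} (hs : 1 < s) : (psEmb L (X - PowerSeries.C γ.zeta))⁻¹ ∈ γ.conv L s := by
  have hz : (γ.zeta : K) ≠ 0 := norm_pos_iff.mp γ.norm_zeta_pos
  have hz' : algebraMap K L γ.zeta ≠ 0 := by simpa using hz
  have e : (psEmb L (X - PowerSeries.C γ.zeta))⁻¹ =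
      PowerSeries.map (algebraMap K L) (PowerSeries.mk fun i => -((γ.zeta : K)⁻¹) ^ (i + 1)) := by
    symm
    rw [PowerSeries.eq_inv_iff_mul_eq_one (by simpa [psEmb, intEmb] using hz)]
    ext n
    rw [psEmb, map_sub, map_X, map_C, mul_sub, map_sub, coeff_mul_C]
    cases n with
    | zero => simp [intEmb, hz']
    | succ n =>
      rw [coeff_succ_mul_X]
      simp [intEmb, pow_succ, hz', coeff_one]
      ring
  rw [mem_conv, e]
  have h := (γ.tendsto_zeta_rpow (sub_pos.2 hs)).const_mul (‖(γ.zeta : K)‖⁻¹)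
  rw [mul_zero] at h
  refine h.congr (fun i => ?_)
  rw [coeff_map, spectralNorm_extends, coeff_mk, norm_neg, norm_pow, norm_inv, sub_mul, one_mul,
    Real.rpow_sub γ.norm_zeta_pos, Real.rpow_natCast]
  have := γ.norm_zeta_pos.ne'
  rw [pow_succ, inv_pow]
  field_simp

/-- The inclusion `R[[z]] → L⟨z/ζ^s⟩`, for `s > 0`. -/
def convEmb {s : ℝ} (hs : 0 < s) : (intRing K)⟦X⟧ →+* γ.conv L s :=
  (psEmb L).codRestrict (γ.conv L s) (γ.psEmb_mem_conv L hs)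

/-- The inclusion `A_ε → L⟨z/ζ^s⟩`, for `s > 0`. -/
def convA {s : ℝ} (hs : 0 < s) : F⟦X⟧ →+* γ.conv L s := (γ.convEmb L hs).comp γ.ofA

/-- The inclusion `L⟨z/ζ^s⟩ → L⟨z/ζ^t⟩` for `s ≤ t`. -/
def convIncl {s t : ℝ} (hst : s ≤ t) : γ.conv L s →+* γ.conv L t :=
  Subring.inclusion (fun _ hf => γ.conv_mono hst hf)

variable {L} in
/-- The action of a `K`-automorphism `g` of `L` on `L⟨z/ζ^s⟩` through the coefficients. -/
def convGal (g : L ≃ₐ[K] L) (s : ℝ) : γ.conv L s →+* γ.conv L s :=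
  (psGal g).restrict _ _ (fun _ hf => γ.psGal_mem_conv g hf)

/-- The homomorphism `σ̂ : L⟨z/ζ^s⟩ → L⟨z/ζ^(s q̂)⟩`. -/
def convSigma [Finite F] (s : ℝ) : γ.conv L s →+* γ.conv L (s * Nat.card F) :=
  (γ.psSigma L).restrict _ _ (fun _ hf => γ.psSigma_mem_conv hf)

theorem convSigma_convEmb [Finite F] {s : ℝ} (hs : 0 < s) (hs' : 0 < s * Nat.card F)
    (a : (intRing K)⟦X⟧) :
    γ.convSigma L s (γ.convEmb L hs a) = γ.convEmb L hs' (γ.sigma a) :=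
  Subtype.ext (γ.psSigma_psEmb L a)

theorem convSigma_convA [Finite F] {s : ℝ} (hs : 0 < s) (hs' : 0 < s * Nat.card F) (a : F⟦X⟧) :
    γ.convSigma L s (γ.convA L hs a) = γ.convA L hs' a :=
  Subtype.ext (γ.psSigma_psA L a)

variable {L} in
theorem convGal_convEmb (g : L ≃ₐ[K] L) {s : ℝ} (hs : 0 < s) (a : (intRing K)⟦X⟧) :
    γ.convGal g s (γ.convEmb L hs a) = γ.convEmb L hs a :=
  Subtype.ext (psGal_psEmb g a)

theorem isUnit_convEmb {s : ℝ} (hs : 0 < s) (hs1 : 1 < s) :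
    IsUnit (γ.convEmb L hs (X - PowerSeries.C γ.zeta)) := by
  refine IsUnit.of_mul_eq_one ⟨_, γ.inv_mem_conv L hs1⟩ (Subtype.ext ?_)
  change psEmb L (X - PowerSeries.C γ.zeta) * (psEmb L (X - PowerSeries.C γ.zeta))⁻¹ = 1
  refine PowerSeries.mul_inv_cancel _ ?_
  have h := norm_pos_iff.mp γ.norm_zeta_pos
  simpa [psEmb, intEmb] using h

end

/-! ### Exponents `s > 1/q̂` -/

section

theorem exp_pos {F : Type u} {s : ℝ} (hs : 1 / (Nat.card F : ℝ) < s) : 0 < s :=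
  lt_of_le_of_lt (by positivity) hs

variable {F : Type u} [Field F] [Finite F] {s : ℝ}

theorem one_lt_exp_mul (hs : 1 / (Nat.card F : ℝ) < s) : 1 < s * Nat.card F :=
  (div_lt_iff₀ (by exact_mod_cast Nat.card_pos)).1 hs

theorem exp_mul (hs : 1 / (Nat.card F : ℝ) < s) : 1 / (Nat.card F : ℝ) < s * Nat.card F :=
  lt_of_le_of_lt (by
    have h : (1 : ℝ) ≤ Nat.card F := by exact_mod_cast Nat.card_pos
    rw [div_le_one (by linarith)]
    exact h) (one_lt_exp_mul hs)

end

end CharMap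

/-! ## Local shtukas -/

section

variable {F : Type u} [Field F] [Finite F] {K : Type v} [NontriviallyNormedField K]
  [IsUltrametricDist K]

/-- A local shtuka over `R`: a finite free `R[[z]]`-module `M` together with an isomorphism
`τ : (σ̂^* M)[1/(z - ζ)] ≅ M[1/(z - ζ)]`. -/
structure LocalShtuka (γ : CharMap F K) where
  carrier : Type w
  [addCommGroup : AddCommGroup carrier]
  [module : Module (intRing K)⟦X⟧ carrier]
  [free : Module.Free (intRing K)⟦X⟧ carrier]
  [finite : Module.Finite (intRing K)⟦X⟧ carrier]
  τ : BaseChange γ.toLoc (BaseChange γ.sigma carrier) ≃ₗ[γ.Loc] BaseChange γ.toLoc carrier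

namespace LocalShtuka

variable {γ : CharMap F K}

attribute [instance] addCommGroup module free finite

/-- The rank of a local shtuka. -/
def rank (M : LocalShtuka.{u, v, w} γ) : ℕ := Module.finrank (intRing K)⟦X⟧ M.carrier

/-- A morphism of local shtukas: an `R[[z]]`-linear map `f : M → N` with
`τ_N ∘ σ̂^* f = f ∘ τ_M`. -/
structure Hom (M N : LocalShtuka.{u, v, w} γ) where
  toLinearMap : M.carrier →ₗ[(intRing K)⟦X⟧] N.carrier
  comm : ∀ m : BaseChange γ.toLoc (BaseChange γ.sigma M.carrier),
    N.τ (BaseChange.map γ.toLoc γ.toLoc (RingHom.id _) (fun _ => rfl)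
        (BaseChange.map γ.sigma γ.sigma (RingHom.id _) (fun _ => rfl) toLinearMap) m) =
      BaseChange.map γ.toLoc γ.toLoc (RingHom.id _) (fun _ => rfl) toLinearMap (M.τ m)

section Frobenius

variable (M N : LocalShtuka.{u, v, w} γ) {B B' : Type*} [CommRing B] [CommRing B']
  (j : (intRing K)⟦X⟧ →+* B) (j' : (intRing K)⟦X⟧ →+* B') (s : B →+* B')
  (hs : ∀ a, s (j a) = j' (γ.sigma a)) (hu : IsUnit (j' (X - PowerSeries.C γ.zeta)))

/-- The canonical map `M[1/(z - ζ)] → M ⊗ B'` for an `R[[z]]`-algebra `B'` in which `z - ζ` is a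
unit. -/
def fromLoc : BaseChange γ.toLoc M.carrier
    →ₛₗ[IsLocalization.Away.lift (S := γ.Loc) (X - PowerSeries.C γ.zeta) hu]
      BaseChange j' M.carrier :=
  BaseChange.map γ.toLoc j' _ (fun a => IsLocalization.Away.lift_eq _ hu a) LinearMap.id

/-- The semilinear map `(τ_M ∘ σ̂_M^*) ⊗ s : M ⊗ B → M ⊗ B'`, `m ⊗ b ↦ τ_M(σ̂_M^* m) ⊗ s(b)`, for
`R[[z]]`-algebras `B` and `B'` and a homomorphism `s : B → B'` compatible with `σ̂`, where `z - ζ` is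
a unit in `B'`. Here `σ̂_M^* m = m ⊗ 1` in `σ̂^* M`. -/
def frob : BaseChange j M.carrier →ₛₗ[s] BaseChange j' M.carrier :=
  BaseChange.lift j s (s.comp j) (fun _ => rfl)
    { toFun := fun m => M.fromLoc j' hu
        (M.τ (BaseChange.of γ.toLoc (BaseChange.of γ.sigma m)))
      map_add' := fun _ _ => by simp only [map_add]
      map_smul' := fun a m => by
        rw [LinearMap.map_smulₛₗ, LinearMap.map_smulₛₗ, map_smul, LinearMap.map_smulₛₗ,
          RingHom.comp_apply, hs, IsLocalization.Away.lift_eq] }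

theorem frob_smul_of (b : B) (m : M.carrier) :
    M.frob j j' s hs hu (b • BaseChange.of j m) = s b • M.fromLoc j' hu
        (M.τ (BaseChange.of γ.toLoc (BaseChange.of γ.sigma m))) :=
  BaseChange.lift_smul_of _ _ _ _ _ _ _

theorem fromLoc_map (f : M.carrier →ₗ[(intRing K)⟦X⟧] N.carrier)
    (g : B' →+* B') (hg : ∀ a, g (j' a) = j' a) (m : BaseChange γ.toLoc M.carrier) :
    BaseChange.map j' j' g hg f (M.fromLoc j' hu m) =
      N.fromLoc j' hu (BaseChange.map γ.toLoc γ.toLoc (RingHom.id _) (fun _ => rfl) f m) := by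
  have key : ∀ c : γ.Loc, g (IsLocalization.Away.lift (X - PowerSeries.C γ.zeta) hu c) =
      IsLocalization.Away.lift (X - PowerSeries.C γ.zeta) hu c := by
    intro c
    have e : g.comp (IsLocalization.Away.lift (S := γ.Loc) (X - PowerSeries.C γ.zeta) hu) =
        IsLocalization.Away.lift (S := γ.Loc) (X - PowerSeries.C γ.zeta) hu := by
      apply IsLocalization.ringHom_ext (Submonoid.powers (X - PowerSeries.C γ.zeta))
      ext1 a
      simp only [RingHom.comp_apply, IsLocalization.Away.lift_eq, hg]
    exact congrArg (fun k => k c) e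
  induction m using BaseChange.induction with
  | h0 => simp
  | hof b m =>
    simp only [fromLoc, BaseChange.map_smul_of, LinearMap.id_apply, RingHom.id_apply, key]
  | hadd x y hx hy => simp only [map_add, hx, hy]

/-- Morphisms and automorphisms of the coefficients commute with the Frobenius. -/
theorem frob_map (f : Hom M N) (g : B →+* B) (hg : ∀ a, g (j a) = j a)
    (g' : B' →+* B') (hg' : ∀ a, g' (j' a) = j' a) (hc : ∀ b, s (g b) = g' (s b))
    (m : BaseChange j M.carrier) :
    N.frob j j' s hs hu (BaseChange.map j j g hg f.toLinearMap m) =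
      BaseChange.map j' j' g' hg' f.toLinearMap (M.frob j j' s hs hu m) := by
  induction m using BaseChange.induction with
  | h0 => simp
  | hof b m =>
    rw [BaseChange.map_smul_of, frob_smul_of, frob_smul_of, LinearMap.map_smulₛₗ, fromLoc_map M N,
      ← f.comm, hc]
    congr 3
    have e1 := BaseChange.map_smul_of γ.toLoc γ.toLoc (RingHom.id _) (fun _ => rfl)
      (BaseChange.map γ.sigma γ.sigma (RingHom.id _) (fun _ => rfl) f.toLinearMap)
      1 (BaseChange.of γ.sigma m)
    have e2 := BaseChange.map_smul_of γ.sigma γ.sigma (RingHom.id _) (fun _ => rfl)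
      f.toLinearMap 1 m
    simp only [one_smul, map_one] at e1 e2
    rw [e1, e2]
  | hadd x y hx hy => simp only [map_add, hx, hy]

/-- The identity morphism. -/
def Hom.id : Hom M M where
  toLinearMap := LinearMap.id
  comm m := by rw [BaseChange.map_id _ _ (BaseChange.map_id _ _ fun _ => rfl), BaseChange.map_id _ _ fun _ => rfl]

end Frobenius

/-! ### Tate modules -/

section Tate

variable (M N : LocalShtuka.{u, v, w} γ) (L : Type x) [Field L] [Algebra K L]

/-- `M ⊗ L[[z]]`. -/
abbrev ps : Type _ := BaseChange (CharMap.psEmb (K := K) L) M.carrier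

/-- `M ⊗ L[[z]]` as a module over `A_ε = F[[z]]`. -/
instance psModuleA : Module F⟦X⟧ (M.ps L) := Module.compHom _ (γ.psA L)

/-- `M ⊗ L((z))`. -/
abbrev ls : Type _ := BaseChange (CharMap.lsEmb (K := K) L) M.carrier

/-- `M ⊗ L((z))` as a vector space over `Q_ε = F((z))`. -/
instance lsModuleQ : Module F⸨X⸩ (M.ls L) := Module.compHom _ (γ.lsQ L)

/-- The `σ̂`-semilinear endomorphism `τ̂` of `M ⊗ L[[z]]`. -/
def psFrob : M.ps L →ₛₗ[γ.psSigma L] M.ps L :=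
  M.frob (CharMap.psEmb L) (CharMap.psEmb L) (γ.psSigma L) (γ.psSigma_psEmb L) (γ.isUnit_psEmb L)

/-- The `σ̂`-semilinear endomorphism `τ̂` of `M ⊗ L((z))`. -/
def lsFrob : M.ls L →ₛₗ[γ.lsSigma L] M.ls L :=
  M.frob (CharMap.lsEmb L) (CharMap.lsEmb L) (γ.lsSigma L) (γ.lsSigma_lsEmb L) (γ.isUnit_lsEmb L)

variable {L} in
/-- The action of `g ∈ Gal(L/K)` on `M ⊗ L[[z]]` through the second factor. -/
def psGal (g : L ≃ₐ[K] L) : M.ps L →ₛₗ[CharMap.psGal g] M.ps L :=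
  BaseChange.map (CharMap.psEmb L) (CharMap.psEmb L) _ (CharMap.psGal_psEmb g) LinearMap.id

variable {L} in
/-- The action of `g ∈ Gal(L/K)` on `M ⊗ L((z))` through the second factor. -/
def lsGal (g : L ≃ₐ[K] L) : M.ls L →ₛₗ[CharMap.lsGal g] M.ls L :=
  BaseChange.map (CharMap.lsEmb L) (CharMap.lsEmb L) _ (CharMap.lsGal_lsEmb g) LinearMap.id

variable {M N} in
/-- The `L[[z]]`-linear map `M ⊗ L[[z]] → N ⊗ L[[z]]` induced by a morphism. -/
def Hom.ps (f : Hom M N) : M.ps L →ₗ[L⟦X⟧] N.ps L :=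
  BaseChange.map (CharMap.psEmb L) (CharMap.psEmb L) (RingHom.id _) (fun _ => rfl) f.toLinearMap

theorem psFrob_psGal (g : L ≃ₐ[K] L) (m : M.ps L) :
    M.psFrob L (M.psGal g m) = M.psGal g (M.psFrob L m) :=
  frob_map M M _ _ _ _ _ (Hom.id M) _ (CharMap.psGal_psEmb g) _ (CharMap.psGal_psEmb g)
    (γ.psSigma_psGal g) m

theorem lsFrob_lsGal (g : L ≃ₐ[K] L) (m : M.ls L) :
    M.lsFrob L (M.lsGal g m) = M.lsGal g (M.lsFrob L m) :=
  frob_map M M _ _ _ _ _ (Hom.id M) _ (CharMap.lsGal_lsEmb g) _ (CharMap.lsGal_lsEmb g)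
    (γ.lsSigma_lsGal g) m

variable {M N} in
theorem psFrob_homPs (f : Hom M N) (m : M.ps L) :
    N.psFrob L (f.ps L m) = f.ps L (M.psFrob L m) :=
  frob_map M N (CharMap.psEmb L) (CharMap.psEmb L) (γ.psSigma L) (γ.psSigma_psEmb L)
    (γ.isUnit_psEmb L) f (RingHom.id L⟦X⟧) (fun _ => rfl) (RingHom.id L⟦X⟧) (fun _ => rfl)
    (fun _ => rfl) m

/-- The (dual) Tate module `{m ∈ M ⊗ L[[z]] : τ_M(σ̂_M^* m) = m}`, an `A_ε`-module. -/
def tate : Submodule F⟦X⟧ (M.ps L) where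
  carrier := {m | M.psFrob L m = m}
  zero_mem' := map_zero _
  add_mem' := fun {a b} ha hb => by
    simp only [Set.mem_ofPred_eq] at *
    rw [map_add, ha, hb]
  smul_mem' := fun c m hm => by
    simp only [Set.mem_ofPred_eq] at *
    change M.psFrob L (γ.psA L c • m) = γ.psA L c • m
    rw [LinearMap.map_smulₛₗ, hm, CharMap.psSigma_psA]

/-- The rational (dual) Tate module `{m ∈ M ⊗ L((z)) : τ_M(σ̂_M^* m) = m}`, a `Q_ε`-vector space. -/
def rationalTate : Submodule F⸨X⸩ (M.ls L) where
  carrier := {m | M.lsFrob L m = m}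
  zero_mem' := map_zero _
  add_mem' := fun {a b} ha hb => by
    simp only [Set.mem_ofPred_eq] at *
    rw [map_add, ha, hb]
  smul_mem' := fun c m hm => by
    simp only [Set.mem_ofPred_eq] at *
    change M.lsFrob L (γ.lsQ L c • m) = γ.lsQ L c • m
    rw [LinearMap.map_smulₛₗ, hm, CharMap.lsSigma_lsQ]

/-- The action of `Gal(L/K)` on the Tate module. -/
def tateRep : Representation F⟦X⟧ (L ≃ₐ[K] L) (M.tate L) where
  toFun g :=
    { toFun := fun t => ⟨M.psGal g t, by
        change M.psFrob L (M.psGal g t) = _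
        rw [psFrob_psGal, show M.psFrob L (t : M.ps L) = (t : M.ps L) from t.2]⟩
      map_add' := fun _ _ => Subtype.ext (map_add _ _ _)
      map_smul' := fun a t => Subtype.ext (by
        change M.psGal g (γ.psA L a • (t : M.ps L)) = γ.psA L a • M.psGal g t
        rw [LinearMap.map_smulₛₗ, CharMap.psGal_psA]) }
  map_one' := by
    ext t
    change M.psGal 1 (t : M.ps L) = (t : M.ps L)
    generalize (t : M.ps L) = m
    refine BaseChange.induction _ (p := fun m => M.psGal (1 : L ≃ₐ[K] L) m = m) (map_zero _)
      (fun b m => ?_) (fun x y hx hy => ?_) m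
    · refine (BaseChange.map_smul_of _ _ _ _ _ _ _).trans ?_
      congr 1
    · rw [map_add, hx, hy]
  map_mul' g g' := by
    ext t
    change M.psGal (g * g') t = M.psGal g (M.psGal g' t)
    generalize (t : M.ps L) = m
    refine BaseChange.induction _ (p := fun m => M.psGal (g * g') m = M.psGal g (M.psGal g' m))
      (by simp only [map_zero]) (fun b m => ?_) (fun x y hx hy => ?_) m
    · refine (BaseChange.map_smul_of _ _ _ _ _ _ _).trans ?_
      refine Eq.trans ?_ (congrArg (M.psGal g) (BaseChange.map_smul_of _ _ _ _ _ _ _).symm)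
      refine Eq.trans ?_ (BaseChange.map_smul_of _ _ _ _ _ _ _).symm
      rfl
    · simp only [map_add, hx, hy]

/-- The action of `Gal(L/K)` on the rational Tate module. -/
def rationalTateRep : Representation F⸨X⸩ (L ≃ₐ[K] L) (M.rationalTate L) where
  toFun g :=
    { toFun := fun t => ⟨M.lsGal g t, by
        change M.lsFrob L (M.lsGal g t) = _
        rw [lsFrob_lsGal, show M.lsFrob L (t : M.ls L) = (t : M.ls L) from t.2]⟩
      map_add' := fun _ _ => Subtype.ext (map_add _ _ _)
      map_smul' := fun a t => Subtype.ext (by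
        change M.lsGal g (γ.lsQ L a • (t : M.ls L)) = γ.lsQ L a • M.lsGal g t
        rw [LinearMap.map_smulₛₗ, CharMap.lsGal_lsQ]) }
  map_one' := by
    ext t
    change M.lsGal 1 (t : M.ls L) = (t : M.ls L)
    generalize (t : M.ls L) = m
    refine BaseChange.induction _ (p := fun m => M.lsGal (1 : L ≃ₐ[K] L) m = m) (map_zero _)
      (fun b m => ?_) (fun x y hx hy => ?_) m
    · refine (BaseChange.map_smul_of _ _ _ _ _ _ _).trans ?_
      congr 1
      exact laurentMap_id _ (fun _ => rfl) b
    · rw [map_add, hx, hy]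
  map_mul' g g' := by
    ext t
    change M.lsGal (g * g') t = M.lsGal g (M.lsGal g' t)
    generalize (t : M.ls L) = m
    refine BaseChange.induction _ (p := fun m => M.lsGal (g * g') m = M.lsGal g (M.lsGal g' m))
      (by simp only [map_zero]) (fun b m => ?_) (fun x y hx hy => ?_) m
    · refine (BaseChange.map_smul_of _ _ _ _ _ _ _).trans ?_
      refine Eq.trans ?_ (congrArg (M.lsGal g) (BaseChange.map_smul_of _ _ _ _ _ _ _).symm)
      refine Eq.trans ?_ (BaseChange.map_smul_of _ _ _ _ _ _ _).symm
      congr 1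
      exact (laurentMap_laurentMap _ _ _ (fun _ => rfl) b).symm
    · simp only [map_add, hx, hy]

variable {M N} in
/-- The map on Tate modules induced by a morphism of local shtukas. -/
def Hom.tate (f : Hom M N) : M.tate L →ₗ[F⟦X⟧] N.tate L where
  toFun t := ⟨f.ps L t, by
    change N.psFrob L (f.ps L t) = _
    rw [psFrob_homPs, show M.psFrob L (t : M.ps L) = (t : M.ps L) from t.2]⟩
  map_add' _ _ := Subtype.ext (map_add _ _ _)
  map_smul' a t := Subtype.ext (map_smul (f.ps L) (γ.psA L a) (t : M.ps L))

/-- `Ť M ⊗_{A_ε} L[[z]]`. -/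
abbrev tatePs : Type _ := BaseChange (γ.psA L) (M.tate L)

/-- The `L[[z]]`-linear map `Ť M ⊗_{A_ε} L[[z]] → M ⊗ L[[z]]`, `t ⊗ b ↦ b t`, induced by the
inclusion `Ť M ⊂ M ⊗ L[[z]]`. -/
def comparison : M.tatePs L →ₗ[L⟦X⟧] M.ps L :=
  BaseChange.lift (γ.psA L) (RingHom.id _) (γ.psA L) (fun _ => rfl)
    { toFun := fun t => (t : M.ps L)
      map_add' := fun _ _ => rfl
      map_smul' := fun _ _ => rfl }

variable {L} in
/-- The action of `g ∈ Gal(L/K)` on both factors of `Ť M ⊗ L[[z]]`. -/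
def tatePsGal (g : L ≃ₐ[K] L) : M.tatePs L →ₛₗ[CharMap.psGal g] M.tatePs L :=
  BaseChange.map _ _ _ (γ.psGal_psA g) (M.tateRep L g)

/-- The endomorphism `τ̂ = id ⊗ σ̂` of `Ť M ⊗ L[[z]]`. -/
def tatePsFrob : M.tatePs L →ₛₗ[γ.psSigma L] M.tatePs L :=
  BaseChange.map _ _ _ (γ.psSigma_psA L) LinearMap.id

variable {M N} in
/-- The map `Ť f ⊗ id` on `Ť M ⊗ L[[z]]` induced by a morphism `f`. -/
def Hom.tatePs (f : Hom M N) : M.tatePs L →ₗ[L⟦X⟧] N.tatePs L :=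
  BaseChange.map _ _ (RingHom.id _) (fun _ => rfl) (f.tate L)

/-- The canonical map `M ⊗ K[[z]] → M ⊗ L[[z]]`. -/
def psBase : M.ps K →ₛₗ[PowerSeries.map (algebraMap K L)] M.ps L :=
  BaseChange.map _ _ _ (fun a => by ext n; simp [CharMap.psEmb, CharMap.intEmb]) LinearMap.id

end Tate

/-! ### The convergent version -/

section Conv

variable [CompleteSpace K] (M N : LocalShtuka.{u, v, w} γ) (L : Type x) [Field L] [Algebra K L]
  [Algebra.IsAlgebraic K L]

/-- `M ⊗ L⟨z/ζ^s⟩`, for `s > 0`. -/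
abbrev cv {s : ℝ} (hs : 0 < s) : Type _ := BaseChange (γ.convEmb L hs) M.carrier

/-- `Ť M ⊗_{A_ε} L⟨z/ζ^s⟩`, for `s > 0`. -/
abbrev tateCv {s : ℝ} (hs : 0 < s) : Type _ := BaseChange (γ.convA L hs) (M.tate L)

/-- The canonical map `M ⊗ L⟨z/ζ^s⟩ → M ⊗ L[[z]]`. -/
def cvToPs {s : ℝ} (hs : 0 < s) : M.cv L hs →ₛₗ[(γ.conv L s).subtype] M.ps L :=
  BaseChange.map _ _ _ (fun _ => rfl) LinearMap.id

/-- The canonical map `Ť M ⊗ L⟨z/ζ^s⟩ → Ť M ⊗ L[[z]]`. -/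
def tateCvToPs {s : ℝ} (hs : 0 < s) : M.tateCv L hs →ₛₗ[(γ.conv L s).subtype] M.tatePs L :=
  BaseChange.map _ _ _ (fun _ => rfl) LinearMap.id

/-- The canonical map `M ⊗ L⟨z/ζ^s⟩ → M ⊗ L⟨z/ζ^t⟩` for `s ≤ t`. -/
def cvIncl {s t : ℝ} (hs : 0 < s) (ht : 0 < t) (hst : s ≤ t) :
    M.cv L hs →ₛₗ[γ.convIncl L hst] M.cv L ht :=
  BaseChange.map _ _ _ (fun _ => rfl) LinearMap.id

/-- The canonical map `Ť M ⊗ L⟨z/ζ^s⟩ → Ť M ⊗ L⟨z/ζ^t⟩` for `s ≤ t`. -/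
def tateCvIncl {s t : ℝ} (hs : 0 < s) (ht : 0 < t) (hst : s ≤ t) :
    M.tateCv L hs →ₛₗ[γ.convIncl L hst] M.tateCv L ht :=
  BaseChange.map _ _ _ (fun _ => rfl) LinearMap.id

variable {L} in
/-- The action of `g ∈ Gal(L/K)` on `M ⊗ L⟨z/ζ^s⟩` through the second factor. -/
def cvGal (g : L ≃ₐ[K] L) {s : ℝ} (hs : 0 < s) : M.cv L hs →ₛₗ[γ.convGal g s] M.cv L hs :=
  BaseChange.map _ _ _ (γ.convGal_convEmb g hs) LinearMap.id

variable {L} in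
/-- The action of `g ∈ Gal(L/K)` on both factors of `Ť M ⊗ L⟨z/ζ^s⟩`. -/
def tateCvGal (g : L ≃ₐ[K] L) {s : ℝ} (hs : 0 < s) :
    M.tateCv L hs →ₛₗ[γ.convGal g s] M.tateCv L hs :=
  BaseChange.map _ _ _ (fun _ => γ.convGal_convEmb g hs _) (M.tateRep L g)

/-- The `σ̂`-semilinear map `(τ_M ∘ σ̂_M^*) ⊗ σ̂ : M ⊗ L⟨z/ζ^s⟩ → M ⊗ L⟨z/ζ^(s q̂)⟩`, for
`s q̂ > 1`. -/
def cvFrob {s : ℝ} (hs : 0 < s) (hs' : 0 < s * Nat.card F) (hs1 : 1 < s * Nat.card F) :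
    M.cv L hs →ₛₗ[γ.convSigma L s] M.cv L hs' :=
  M.frob _ _ _ (γ.convSigma_convEmb L hs hs') (γ.isUnit_convEmb L hs' hs1)

/-- The `σ̂`-semilinear map `id ⊗ σ̂ : Ť M ⊗ L⟨z/ζ^s⟩ → Ť M ⊗ L⟨z/ζ^(s q̂)⟩`. -/
def tateCvFrob {s : ℝ} (hs : 0 < s) (hs' : 0 < s * Nat.card F) :
    M.tateCv L hs →ₛₗ[γ.convSigma L s] M.tateCv L hs' :=
  BaseChange.map _ _ _ (γ.convSigma_convA L hs hs') LinearMap.id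

variable {M N} in
/-- The linear map `M ⊗ L⟨z/ζ^s⟩ → N ⊗ L⟨z/ζ^s⟩` induced by a morphism. -/
def Hom.cv (f : Hom M N) {s : ℝ} (hs : 0 < s) : M.cv L hs →ₗ[γ.conv L s] N.cv L hs :=
  BaseChange.map _ _ (RingHom.id _) (fun _ => rfl) f.toLinearMap

variable {M N} in
/-- The linear map `Ť M ⊗ L⟨z/ζ^s⟩ → Ť N ⊗ L⟨z/ζ^s⟩` induced by a morphism. -/
def Hom.tateCv (f : Hom M N) {s : ℝ} (hs : 0 < s) : M.tateCv L hs →ₗ[γ.conv L s] N.tateCv L hs :=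
  BaseChange.map _ _ (RingHom.id _) (fun _ => rfl) (f.tate L)

end Conv

end LocalShtuka

end

/-! ## Continuity of representations -/

/-- A representation of a topological group `G` on an `F[[z]]`-module `T` is continuous (for the
`z`-adic topology) if for every `n` the set of all `g` acting trivially modulo `z ^ n` is open. -/
def IsContinuousIntegralRep {F G T : Type*} [Field F] [Group G] [TopologicalSpace G]
    [AddCommGroup T] [Module F⟦X⟧ T] (ρ : Representation F⟦X⟧ G T) : Prop :=
  ∀ n : ℕ, IsOpen {g : G | ∀ t : T, ∃ t' : T, ρ g t - t = (X : F⟦X⟧) ^ n • t'}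

/-- A representation of a topological group `G` on an `F((z))`-vector space `V` is continuous if
the action map `G × V → V` is continuous, where `V` carries the module topology induced from the
`z`-adic topology of `F((z))` (the canonical topology if `V` is finite dimensional). -/
def IsContinuousRationalRep {F G V : Type*} [Field F] [Group G] [TopologicalSpace G]
    [AddCommGroup V] [Module F⸨X⸩ V] (ρ : Representation F⸨X⸩ G V) : Prop :=
  letI : TopologicalSpace V := moduleTopology F⸨X⸩ V
  Continuous fun p : G × V => ρ p.1 p.2

end

/-! ## Semilinear Frobenius modules over a separably closed field -/

/-! In a basis of `M` the map `τ̂` reads `x ↦ Φ σ̂(x)`, where `Φ` is invertible over `R[[z]][1/(z -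
ζ)]` and hence over `L[[z]]`, `L` being the separable closure. Everything rests on one invertible
matrix `U` over `L[[z]]` with `Φ σ̂(U) = U` (`exists_isUnit_fixed_matrix`). Its columns form a basis
of `τ̂`-invariant vectors. In such a basis a vector is invariant iff its coordinates are
`σ̂`-invariant, that is, iff they lie in `A_ε` (in `Q_ε` over `L((z))`), because the solutions of `a
^ q̂ = a` in `L` are the elements of the finite field. So the same vectors are an `A_ε`-basis of the
Tate module and a `Q_ε`-basis of the rational one, and the comparison map carries a basis to a
basis.

To find `U`, reduce modulo `z`: Lang's theorem (`span_fixed_eq_top`) gives a basis of fixed vectors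
of `x ↦ Φ₀ s(x)`. Since `1 - Φ₀ s` is moreover surjective (`exists_sub_eq`), the higher coefficients
can be solved for one at a time.

For convergence, `σ̂(U) = Φ⁻¹ U` and `σ̂(U⁻¹) = U⁻¹ Φ`, with `Φ` and `Φ⁻¹` convergent for every
exponent `s > 1`. The `q̂`-th power on the left dominates the linear right-hand side, which bounds
the coefficients of a solution (`norm_coeff_le_of_frobenius_eq`). Convergence of `σ̂(y)` at `s q̂`
is convergence of `y` at `s`, so the equation can be iterated down to every `s > 1/q̂`
(`mem_conv_of_frobenius_eq`). Hence `U` is invertible over the convergent rings as well.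

Continuity holds because the invariant basis modulo `z ^ n` involves finitely many elements of `L`,
each with open stabilizer. Galois descent is coefficientwise, in a basis coming from `M`. -/

section Lang

variable {L : Type*} [Field L] {q : ℕ}

/-- The additive polynomials given by the recursion `p₀ = a₀ Y^q`, `pᵢ₊₁ = pᵢ^q + aᵢ₊₁ Y^q`. -/
noncomputable def cyclicPoly (q : ℕ) (a : ℕ → L) : ℕ → Polynomial L
  | 0 => Polynomial.C (a 0) * Polynomial.X ^ q
  | i + 1 => cyclicPoly q a i ^ q + Polynomial.C (a (i + 1)) * Polynomial.X ^ q

theorem X_pow_dvd_cyclicPoly (hq : 2 ≤ q) (a : ℕ → L) (i : ℕ) :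
    Polynomial.X ^ q ∣ cyclicPoly q a i := by
  induction i with
  | zero => exact Dvd.intro_left _ rfl
  | succ i ih =>
    exact dvd_add (ih.trans (dvd_pow_self _ (by omega))) (Dvd.intro_left _ rfl)

/-- The `q`-th power of the previous polynomial is divisible by `Y ^ (q * q)`, so the coefficient of
`Y ^ q` is the newest `a` alone; once it vanishes, so does the previous polynomial. -/
theorem eq_zero_of_cyclicPoly_eq_zero (hq : 2 ≤ q) (a : ℕ → L) (i : ℕ)
    (h : cyclicPoly q a i = 0) (j : ℕ) (hj : j ≤ i) : a j = 0 := by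
  induction i with
  | zero =>
    obtain rfl : j = 0 := by omega
    simpa [cyclicPoly] using h
  | succ i ih =>
    have h1 : a (i + 1) = 0 := by
      obtain ⟨r, hr⟩ := X_pow_dvd_cyclicPoly hq a i
      have h2 := congrArg (fun p => Polynomial.coeff p q) h
      have h3 : ¬ q * q ≤ q := by nlinarith
      simpa [cyclicPoly, hr, mul_pow, ← pow_mul, Polynomial.coeff_X_pow_mul', h3] using h2
    have h2 : cyclicPoly q a i = 0 := by
      simp only [cyclicPoly, h1, map_zero, zero_mul, add_zero] at h
      exact eq_zero_of_pow_eq_zero h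
    rcases Nat.lt_or_ge i j with h3 | h3
    · obtain rfl : j = i + 1 := by omega
      exact h1
    · exact ih h2 h3

theorem derivative_cyclicPoly (hq0 : (q : L) = 0) (a : ℕ → L) (i : ℕ) :
    Polynomial.derivative (cyclicPoly q a i) = 0 := by
  have h : (q : Polynomial L) = 0 := by
    rw [← map_natCast (Polynomial.C : L →+* Polynomial L), hq0, map_zero]
  cases i <;> simp [cyclicPoly, Polynomial.derivative_pow, hq0]

/-- With `p = Y ^ q * r`, the polynomial `p - Y` has derivative `-1`, so it is separable, and it
factors as `Y * (Y ^ (q - 1) * r - 1)`. The second factor is not constant since `r ≠ 0`, and a root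
of it cannot be `0`. -/
theorem exists_ne_zero_eval_cyclicPoly [IsSepClosed L] (hq : 2 ≤ q) (hq0 : (q : L) = 0)
    (a : ℕ → L) (i j : ℕ) (hj : j ≤ i) (ha : a j ≠ 0) :
    ∃ y : L, y ≠ 0 ∧ (cyclicPoly q a i).eval y = y := by
  obtain ⟨r, hr⟩ := X_pow_dvd_cyclicPoly hq a i
  have hr0 : r ≠ 0 := by
    rintro rfl
    exact ha (eq_zero_of_cyclicPoly_eq_zero hq a i (by simpa using hr) j hj)
  obtain ⟨m, rfl⟩ : ∃ m, q = m + 2 := ⟨q - 2, by omega⟩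
  have hP : cyclicPoly (m + 2) a i - Polynomial.X =
      Polynomial.X * (Polynomial.X ^ (m + 1) * r - 1) := by rw [hr]; ring
  have hsep : (cyclicPoly (m + 2) a i - Polynomial.X).Separable := by
    rw [Polynomial.separable_def, Polynomial.derivative_sub, derivative_cyclicPoly hq0,
      Polynomial.derivative_X, zero_sub]
    exact isCoprime_one_right.neg_right
  have hdeg : (Polynomial.X ^ (m + 1) * r - 1 : Polynomial L).degree ≠ 0 := by
    intro h
    have h1 := Polynomial.eq_C_of_degree_eq_zero h
    have h2 : Polynomial.X ^ (m + 1) * r = Polynomial.C (Polynomial.coeff (Polynomial.X ^ (m + 1) * r - 1) 0 + 1) := by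
      rw [map_add, ← h1]; simp
    have h3 := congrArg Polynomial.natDegree h2
    rw [Polynomial.natDegree_C, Polynomial.natDegree_mul (by simp) hr0,
      Polynomial.natDegree_X_pow] at h3
    omega
  obtain ⟨y, hy⟩ := IsSepClosed.exists_root _ hdeg (hsep.of_dvd (Dvd.intro_left _ hP.symm))
  have hy' : y ^ (m + 1) * r.eval y = 1 := by
    have := hy
    rw [Polynomial.IsRoot.def] at this
    simpa [sub_eq_zero] using this
  refine ⟨y, ?_, ?_⟩
  · rintro rfl
    simp at hy'
  · rw [hr, Polynomial.eval_mul, Polynomial.eval_pow, Polynomial.eval_X]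
    linear_combination y * hy'

variable {s : L →+* L} {V : Type*} [AddCommGroup V] [Module L V]

/-- Cut the orbit of `v` at its first linear dependence. The minimal dependent length is at least
two because `v ≠ 0`. -/
theorem exists_pow_linearIndependent [FiniteDimensional L V] (φ : V → V) {v : V} (hv : v ≠ 0) :
    ∃ d : ℕ, LinearIndependent L (fun i : Fin (d + 1) => φ^[i] v) ∧
      φ^[d + 1] v ∈ Submodule.span L (Set.range fun i : Fin (d + 1) => φ^[i] v) := by
  classical
  have hex : ∃ n : ℕ, ¬ LinearIndependent L (fun i : Fin n => φ^[i] v) := by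
    refine ⟨Module.finrank L V + 1, fun h => ?_⟩
    have := h.fintype_card_le_finrank
    simp at this
  have h0 : Nat.find hex ≠ 0 := by
    intro h
    apply Nat.find_spec hex
    rw [h]
    exact linearIndependent_empty_type
  have h1 : Nat.find hex ≠ 1 := by
    intro h
    apply Nat.find_spec hex
    rw [h]
    rw [linearIndependent_unique_iff]
    simpa using hv
  obtain ⟨d, hd⟩ : ∃ d, Nat.find hex = d + 2 := ⟨Nat.find hex - 2, by omega⟩
  have hli : LinearIndependent L (fun i : Fin (d + 1) => φ^[i] v) :=
    not_not.1 (Nat.find_min hex (by omega))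
  refine ⟨d, hli, ?_⟩
  have hspec := Nat.find_spec hex
  rw [hd, linearIndependent_finSucc'] at hspec
  by_contra hcon
  exact hspec ⟨hli, hcon⟩

/-- An injective `q`-Frobenius semilinear endomorphism of a nonzero finite dimensional vector space
over a separably closed field has a nonzero fixed vector. -/
theorem exists_ne_zero_fixed [IsSepClosed L] (hq : 2 ≤ q) (hq0 : (q : L) = 0)
    (hs : ∀ a, s a = a ^ q) [FiniteDimensional L V] (φ : V →ₛₗ[s] V)
    (hφ : Function.Injective φ) {v : V} (hv : v ≠ 0) : ∃ x : V, x ≠ 0 ∧ φ x = x := by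
  obtain ⟨d, hli, hmem⟩ := exists_pow_linearIndependent (L := L) φ hv
  obtain ⟨c, hc⟩ := (Submodule.mem_span_range_iff_exists_fun L).1 hmem
  let a : ℕ → L := fun i => if h : i < d + 1 then c ⟨i, h⟩ else 0
  have ha : ∀ i : Fin (d + 1), a i = c i := fun i => dif_pos i.2
  have hsum : φ^[d + 1] v = ∑ i ∈ Finset.range (d + 1), a i • φ^[i] v := by
    rw [← hc, Finset.sum_range]
    simp only [ha]
  have hne : φ^[d + 1] v ≠ 0 := by
    have h0 : φ^[d + 1] 0 = 0 := Function.iterate_fixed (map_zero φ) _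
    intro h
    exact hv (hφ.iterate (d + 1) (h.trans h0.symm))
  -- Injectivity of `φ` keeps the orbit away from `0`, so the recurrence cannot be trivial.
  obtain ⟨j, hj, haj⟩ : ∃ j, j ≤ d ∧ a j ≠ 0 := by
    by_contra! hcon
    refine hne (hsum.trans (Finset.sum_eq_zero fun i hi => ?_))
    rw [hcon i (by simpa [Nat.lt_succ_iff] using hi), zero_smul]
  obtain ⟨y, hy0, hy⟩ := exists_ne_zero_eval_cyclicPoly hq hq0 a d j hj haj
  -- Comparing coefficients in `φ x = x` for `x = ∑ ξᵢ φ^[i] v` gives `ξ₀ = a₀ ξ_d ^ q` and `ξᵢ₊₁ =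
  -- ξᵢ ^ q + aᵢ₊₁ ξ_d ^ q`. With `ξ_d = y` this forces `ξᵢ = pᵢ(y)`, and the only remaining
  -- condition is `p_d(y) = y`.
  let ξ : ℕ → L := fun i => (cyclicPoly q a i).eval y
  have hξ0 : ξ 0 = a 0 * y ^ q := by simp [ξ, cyclicPoly]
  have hξ1 : ∀ i, ξ (i + 1) = ξ i ^ q + a (i + 1) * y ^ q := fun i => by simp [ξ, cyclicPoly]
  have hξd : ξ d = y := hy
  refine ⟨∑ i ∈ Finset.range (d + 1), ξ i • φ^[i] v, ?_, ?_⟩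
  · intro h
    rw [Finset.sum_range] at h
    have := Fintype.linearIndependent_iff.1 hli (fun i => ξ i) h (Fin.last d)
    exact hy0 (hξd.symm.trans (by simpa using this))
  · have e1 : φ (∑ i ∈ Finset.range (d + 1), ξ i • φ^[i] v) =
        ∑ i ∈ Finset.range d, ξ i ^ q • φ^[i + 1] v + y ^ q • φ^[d + 1] v := by
      rw [Finset.sum_range_succ, map_add, map_sum]
      simp only [LinearMap.map_smulₛₗ, hs, hξd, Function.iterate_succ_apply']
    rw [e1, hsum, Finset.smul_sum, Finset.sum_range_succ' (fun i => y ^ q • a i • φ^[i] v),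
      ← add_assoc, ← Finset.sum_add_distrib, Finset.sum_range_succ' (fun i => ξ i • φ^[i] v)]
    simp only [hξ1, hξ0, add_smul, smul_smul, mul_comm]

/-- A nonzero kernel vector extends to a basis. The images of that basis span, hence are independent
by counting, so none of them can be `0`. -/
theorem injective_of_span_range_eq_top [FiniteDimensional L V] (φ : V →ₛₗ[s] V)
    (h : Submodule.span L (Set.range φ) = ⊤) : Function.Injective φ := by
  rw [injective_iff_map_eq_zero]
  intro w hw
  by_contra hw0
  have hli : LinearIndepOn L id {w} := LinearIndepOn.singleton (by simpa using hw0)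
  let b := Module.Basis.extend hli
  have := Module.Finite.finite_basis b
  let _ := Fintype.ofFinite (hli.extend (Set.subset_univ _))
  have hspan : ⊤ ≤ Submodule.span L (Set.range (φ ∘ b)) := by
    rw [← h, Submodule.span_le]
    rintro _ ⟨x, rfl⟩
    rw [← b.sum_repr x, map_sum]
    refine Submodule.sum_mem _ fun i _ => ?_
    rw [LinearMap.map_smulₛₗ]
    exact Submodule.smul_mem _ _ (Submodule.subset_span ⟨i, rfl⟩)
  have hli' := linearIndependent_of_top_le_span_of_card_eq_finrank hspan
    (Module.finrank_eq_card_basis b).symm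
  have hmem : w ∈ hli.extend (Set.subset_univ _) := Module.Basis.subset_extend hli rfl
  refine hli'.ne_zero ⟨w, hmem⟩ ?_
  rw [Function.comp_apply, Module.Basis.extend_apply_self]
  exact hw

/-- The Artin–Schreier polynomial `X ^ q - X + c` has derivative `-1`, hence is separable. -/
theorem exists_sub_pow_eq [IsSepClosed L] (hq : 2 ≤ q) (hq0 : (q : L) = 0) (c : L) :
    ∃ u : L, u - u ^ q = c := by
  let P : Polynomial L := Polynomial.X ^ q - (Polynomial.X - Polynomial.C c)
  have hdeg : P.degree ≠ 0 := by
    have : P.degree = q := by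
      refine (Polynomial.degree_sub_eq_left_of_degree_lt ?_).trans (Polynomial.degree_X_pow q)
      rw [Polynomial.degree_X_sub_C, Polynomial.degree_X_pow]
      exact_mod_cast hq
    rw [this]
    exact_mod_cast (by omega : q ≠ 0)
  have hsep : P.Separable := by
    have : Polynomial.derivative P = -1 := by simp [P, hq0, Polynomial.derivative_X_pow]
    rw [Polynomial.separable_def, this]
    exact isCoprime_one_right.neg_right
  obtain ⟨u, hu⟩ := IsSepClosed.exists_root P hdeg hsep
  refine ⟨u, ?_⟩
  simp only [P, Polynomial.IsRoot.def, Polynomial.eval_sub, Polynomial.eval_pow,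
    Polynomial.eval_X, Polynomial.eval_C] at hu
  linear_combination -hu

/-- On a multiple `r • x` of a fixed vector, `1 - φ` acts as `a ↦ a - a ^ q` on the scalar. Keeping
the solution inside the span is what lets fixed vectors be lifted from the quotient by this span. -/
theorem exists_sub_eq_of_mem_span_fixed [IsSepClosed L] (hq : 2 ≤ q) (hq0 : (q : L) = 0)
    (hs : ∀ a, s a = a ^ q) (φ : V →ₛₗ[s] V) {c : V}
    (hc : c ∈ Submodule.span L {x | φ x = x}) :
    ∃ u ∈ Submodule.span L {x | φ x = x}, u - φ u = c := by
  induction hc using Submodule.closure_induction with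
  | zero => exact ⟨0, Submodule.zero_mem _, by simp⟩
  | add x y _ _ hx hy =>
    obtain ⟨u, hu, rfl⟩ := hx
    obtain ⟨u', hu', rfl⟩ := hy
    exact ⟨u + u', Submodule.add_mem _ hu hu', by rw [map_add]; abel⟩
  | smul_mem r x hx =>
    obtain ⟨a, rfl⟩ := exists_sub_pow_eq hq hq0 r
    refine ⟨a • x, Submodule.smul_mem _ _ (Submodule.subset_span hx), ?_⟩
    have hx' : φ x = x := hx
    rw [LinearMap.map_smulₛₗ, hx', hs, sub_smul]

/-- **Lang's theorem**: over a separably closed field, an étale `q`-Frobenius module is spanned by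
its fixed vectors. -/
theorem span_fixed_eq_top [IsSepClosed L] (hq : 2 ≤ q) (hq0 : (q : L) = 0)
    (hs : ∀ a, s a = a ^ q) [FiniteDimensional L V] (φ : V →ₛₗ[s] V)
    (h : Submodule.span L (Set.range φ) = ⊤) : Submodule.span L {x | φ x = x} = ⊤ := by
  set W := Submodule.span L {x | φ x = x} with hW
  have hle : W ≤ W.comap φ := by
    rw [hW, Submodule.span_le]
    intro x hx
    have hx' : φ x = x := hx
    simpa [hx'] using Submodule.subset_span hx
  let ψ : V ⧸ W →ₛₗ[s] V ⧸ W := W.mapQ W φ hle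
  have hψ : Submodule.span L (Set.range ψ) = ⊤ := by
    rw [eq_top_iff, ← W.range_mkQ, ← Submodule.map_top, ← h, Submodule.map_span, Submodule.span_le]
    rintro _ ⟨_, ⟨x, rfl⟩, rfl⟩
    exact Submodule.subset_span ⟨W.mkQ x, rfl⟩
  by_contra hcon
  obtain ⟨v, hv⟩ : ∃ v, v ∉ W := by
    by_contra! hall
    exact hcon (eq_top_iff.2 fun x _ => hall x)
  -- If `W` were proper, `V ⧸ W` would contain a nonzero fixed vector, the class of some `w`.
  -- Correcting `w` by an element `u` of `W` makes it fixed in `V`, which puts `w` itself in `W`.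
  obtain ⟨x, hx0, hx⟩ := exists_ne_zero_fixed hq hq0 hs ψ (injective_of_span_range_eq_top ψ hψ)
    (v := W.mkQ v) (by simpa using hv)
  obtain ⟨w, rfl⟩ := W.mkQ_surjective x
  have hmem : φ w - w ∈ W := (Submodule.Quotient.eq W).1 hx
  obtain ⟨u, hu, hu'⟩ := exists_sub_eq_of_mem_span_fixed hq hq0 hs φ hmem
  have hfix : w + u ∈ W := Submodule.subset_span (by
    change φ (w + u) = w + u
    rw [map_add]
    rw [← sub_add_cancel (φ w) w, ← hu']
    abel)
  refine hx0 ?_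
  rw [Submodule.mkQ_apply, Submodule.Quotient.mk_eq_zero]
  simpa using W.sub_mem hfix hu

theorem exists_sub_eq [IsSepClosed L] (hq : 2 ≤ q) (hq0 : (q : L) = 0)
    (hs : ∀ a, s a = a ^ q) [FiniteDimensional L V] (φ : V →ₛₗ[s] V)
    (h : Submodule.span L (Set.range φ) = ⊤) (c : V) : ∃ u, u - φ u = c := by
  obtain ⟨u, -, hu⟩ := exists_sub_eq_of_mem_span_fixed hq hq0 hs φ (c := c)
    (by rw [span_fixed_eq_top hq hq0 hs φ h]; trivial)
  exact ⟨u, hu⟩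

end Lang

/-! ## Lifting fixed vectors to power series -/

section Lifting

open Matrix

variable {L : Type*} [Field L] {q : ℕ} {s : L →+* L} {n : Type*} [Fintype n]

/-- The semilinear map `x ↦ A s(x)` on column vectors. -/
def semilinearMulVec (s : L →+* L) (A : Matrix n n L) : (n → L) →ₛₗ[s] (n → L) where
  toFun x := A *ᵥ (fun j => s (x j))
  map_add' x y := by
    rw [← Matrix.mulVec_add]
    congr 1
    ext j
    simp
  map_smul' c x := by
    rw [← Matrix.mulVec_smul]
    congr 1
    ext j
    simp

/-- Since `s` fixes `0` and `1`, the standard basis vectors are sent to the columns of `A`. -/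
theorem span_range_semilinearMulVec [DecidableEq n] {A : Matrix n n L} (hA : IsUnit A) :
    Submodule.span L (Set.range (semilinearMulVec s A)) = ⊤ := by
  obtain ⟨B, hB⟩ := hA.exists_right_inv
  rw [eq_top_iff]
  intro y _
  have hy : y = ∑ j, (B *ᵥ y) j • semilinearMulVec s A (Pi.single j 1) := by
    have h1 : ∀ j, semilinearMulVec s A (Pi.single j 1) = A *ᵥ Pi.single j 1 := by
      intro j
      change A *ᵥ _ = _
      congr 1
      ext k
      rcases eq_or_ne k j with rfl | h
      · simp
      · simp [h]
    calc y = A *ᵥ (B *ᵥ y) := by rw [Matrix.mulVec_mulVec, hB, Matrix.one_mulVec]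
      _ = A *ᵥ (∑ j, (B *ᵥ y) j • Pi.single j 1) := by
        congr 1
        ext k
        simp [Finset.sum_apply, Pi.single_apply]
      _ = _ := by
        rw [Matrix.mulVec_sum]
        simp only [h1, Matrix.mulVec_smul]
  rw [hy]
  exact Submodule.sum_mem _ fun j _ => Submodule.smul_mem _ _ (Submodule.subset_span ⟨_, rfl⟩)

/-- The coefficients of a fixed vector of `x ↦ Φ σ̂(x)` with given constant coefficient, for a
section `g` of `x ↦ x - Φ₀ s(x)`. -/
noncomputable def fixedCoeff (s : L →+* L) (Φ : Matrix n n L⟦X⟧) (g : (n → L) → (n → L))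
    (v : n → L) : ℕ → n → L
  | 0 => v
  | k + 1 => g fun i => ∑ j, ∑ m : Fin (k + 1),
      s (fixedCoeff s Φ g v m j) * coeff (k + 1 - m) (Φ i j)

/-- The coefficient of `z ^ k` in the fixed-point equation reads `a_k - Φ₀ s(a_k) = ∑_{m < k}
Φ_{k-m} s(a_m)`. For `k > 0` the section `g` solves it in terms of earlier coefficients; for `k = 0`
it says that `v` is fixed. -/
theorem exists_fixed_lift {Φ : Matrix n n L⟦X⟧} {g : (n → L) → (n → L)}
    (hg : ∀ c, g c - semilinearMulVec s (Φ.map constantCoeff) (g c) = c) {v : n → L}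
    (hv : semilinearMulVec s (Φ.map constantCoeff) v = v) :
    ∃ y : n → L⟦X⟧, (∀ i, constantCoeff (y i) = v i) ∧
      ∀ i, ∑ j, Φ i j * PowerSeries.map s (y j) = y i := by
  let a := fixedCoeff s Φ g v
  refine ⟨fun i => PowerSeries.mk fun k => a k i, fun i => ?_, fun i => ?_⟩
  · rw [← coeff_zero_eq_constantCoeff_apply, coeff_mk]
    simp only [a, fixedCoeff]
  · ext k
    have h0 : ∀ k, coeff k (∑ j, Φ i j * PowerSeries.map s (PowerSeries.mk fun k => a k j)) =
        ∑ j, ∑ m ∈ Finset.range k, s (a m j) * coeff (k - m) (Φ i j) +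
          semilinearMulVec s (Φ.map constantCoeff) (a k) i := by
      intro k
      change _ = _ + ∑ j, constantCoeff (Φ i j) * s (a k j)
      rw [map_sum, ← Finset.sum_add_distrib]
      refine Finset.sum_congr rfl fun j _ => ?_
      rw [mul_comm, coeff_mul, Finset.Nat.sum_antidiagonal_eq_sum_range_succ_mk,
        Finset.sum_range_succ]
      simp [mul_comm]
    rw [h0, coeff_mk]
    cases k with
    | zero =>
      have h1 : a 0 = v := by simp only [a, fixedCoeff]
      simp [h1, hv]
    | succ k =>
      have h1 : a (k + 1) = g fun i => ∑ j, ∑ m : Fin (k + 1),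
          s (a m j) * coeff (k + 1 - m) (Φ i j) := by simp only [a, fixedCoeff]
      have h2 := congrFun (hg fun i => ∑ j, ∑ m : Fin (k + 1),
          s (a m j) * coeff (k + 1 - m) (Φ i j)) i
      rw [← h1, Pi.sub_apply, sub_eq_iff_eq_add] at h2
      rw [h2]
      simp only [Finset.sum_range]

/-- Lift a basis of fixed vectors modulo `z` column by column. Modulo `z` the resulting matrix is a
change of basis, and a matrix over `L[[z]]` is invertible as soon as it is so modulo `z`. -/
theorem exists_isUnit_fixed_matrix [DecidableEq n] [IsSepClosed L] (hq : 2 ≤ q)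
    (hq0 : (q : L) = 0) (hs : ∀ a, s a = a ^ q) {Φ : Matrix n n L⟦X⟧} (hΦ : IsUnit Φ) :
    ∃ U : Matrix n n L⟦X⟧, IsUnit U ∧ Φ * U.map (PowerSeries.map s) = U := by
  have hΦ0 : IsUnit (Φ.map (constantCoeff (R := L))) :=
    hΦ.map (RingHom.mapMatrix (constantCoeff (R := L)))
  have hspan := span_range_semilinearMulVec (s := s) hΦ0
  choose g hg using exists_sub_eq hq hq0 hs _ hspan
  have hfix := span_fixed_eq_top hq hq0 hs _ hspan
  let b' := Module.Basis.ofSpan hfix.ge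
  let b := b'.reindex (b'.indexEquiv (Pi.basisFun L n))
  have hb : ∀ j, semilinearMulVec s (Φ.map constantCoeff) (b j) = b j := by
    intro j
    have : b j ∈ {x | semilinearMulVec s (Φ.map constantCoeff) x = x} :=
      Module.Basis.ofSpan_subset hfix.ge (by
        rw [Module.Basis.reindex_apply]
        exact ⟨_, rfl⟩)
    exact this
  choose y hy0 hy using fun j => exists_fixed_lift hg (hb j)
  refine ⟨Matrix.of fun i j => y j i, ?_, ?_⟩
  · rw [Matrix.isUnit_iff_isUnit_det, PowerSeries.isUnit_iff_constantCoeff,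
      RingHom.map_det, ← Matrix.isUnit_iff_isUnit_det]
    have e : (constantCoeff (R := L)).mapMatrix (Matrix.of fun i j => y j i) =
        (Pi.basisFun L n).toMatrix b := by
      ext i j
      simp [Module.Basis.toMatrix_apply, hy0]
    rw [e]
    have := (Pi.basisFun L n).invertibleToMatrix b
    exact isUnit_of_invertible _
  · ext1 i j
    rw [Matrix.mul_apply]
    exact hy j i

end Lifting

/-! ## Growth of the coefficients of solutions of Frobenius equations -/

section Growth

variable {L : Type*} [NormedField L] [IsUltrametricDist L] {n : Type*} [Fintype n]

/-- Let `t` be the largest norm of a `k`-th coefficient and suppose `t > C ρ ^ k`. Products with the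
constant term of `Ψ` have norm at most `C t`. The others are at most `C * (C ρ ^ k) ≤ C t` by
induction. So `t ^ 2 ≤ t ^ q ≤ C t`, contradicting `t > C`. -/
theorem norm_coeff_le_of_frobenius_eq {q : ℕ} (hq : 2 ≤ q) {Ψ : Matrix n n L⟦X⟧} {y : n → L⟦X⟧}
    (hy : ∀ i k, coeff k (y i) ^ q = coeff k (∑ j, Ψ i j * y j)) {C ρ : ℝ} (hC : 1 ≤ C)
    (hρ : 1 ≤ ρ) (hΨ : ∀ i j k, ‖coeff k (Ψ i j)‖ ≤ C * ρ ^ k) (i : n) (k : ℕ) :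
    ‖coeff k (y i)‖ ≤ C * ρ ^ k := by
  induction k using Nat.strong_induction_on generalizing i with
  | _ k ih =>
    have : Nonempty n := ⟨i⟩
    obtain ⟨m, hm⟩ := Finite.exists_max fun i => ‖coeff k (y i)‖
    refine (hm i).trans ?_
    by_contra! hlt
    set t := ‖coeff k (y m)‖ with ht
    have hCt : C < t := lt_of_le_of_lt (le_mul_of_one_le_right (by linarith)
      (one_le_pow₀ hρ)) hlt
    have h1 : t ^ q ≤ C * t := by
      rw [ht, ← norm_pow, hy, map_sum]
      have hnn : 0 ≤ C * ‖coeff k (y m)‖ := mul_nonneg (by linarith) (norm_nonneg _)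
      refine IsUltrametricDist.norm_sum_le_of_forall_le_of_nonneg hnn fun j _ => ?_
      rw [coeff_mul]
      refine IsUltrametricDist.norm_sum_le_of_forall_le_of_nonneg hnn fun p hp => ?_
      rw [Finset.HasAntidiagonal.mem_antidiagonal] at hp
      rw [norm_mul]
      rcases Nat.eq_zero_or_pos p.1 with h0 | h0
      · have h2 : p.2 = k := by omega
        rw [h2, h0]
        refine mul_le_mul ?_ (hm j) (norm_nonneg _) (by linarith)
        simpa using hΨ m j 0
      · have h3 := mul_le_mul (hΨ m j p.1) (ih p.2 (by omega) j) (norm_nonneg _)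
          (mul_nonneg (by linarith) (by positivity))
        refine h3.trans ?_
        calc C * ρ ^ p.1 * (C * ρ ^ p.2) = C * (C * ρ ^ k) := by rw [← hp, pow_add]; ring
          _ ≤ C * t := mul_le_mul_of_nonneg_left hlt.le (by linarith)
    have h2 : t ^ 2 ≤ t ^ q := pow_le_pow_right₀ (by linarith) hq
    nlinarith

end Growth

/-! ### Convergence of solutions of Frobenius equations -/

namespace CharMap

theorem two_le_card (F : Type*) [Field F] [Finite F] : 2 ≤ Nat.card F := Finite.one_lt_card

theorem coeff_psSigma {F : Type u} [Field F] [Finite F] {K : Type v} [NontriviallyNormedField K]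
    [IsUltrametricDist K] (γ : CharMap F K) {L : Type x} [Field L] [Algebra K L] (f : L⟦X⟧)
    (k : ℕ) : coeff k (γ.psSigma L f) = coeff k f ^ Nat.card F := by
  simp [psSigma, qFrob]

section

variable {F : Type u} [Field F] [Finite F] {K : Type v} [NontriviallyNormedField K]
  [IsUltrametricDist K] [CompleteSpace K] (γ : CharMap F K) {L : Type x} [Field L] [Algebra K L]
  [Algebra.IsAlgebraic K L]

/-- The terms that must tend to `0` for `σ̂ f` at exponent `s q̂` are the `q̂`-th powers of those
for `f` at exponent `s`. -/
theorem mem_conv_of_psSigma_mem {s : ℝ} {f : L⟦X⟧} (hf : γ.psSigma L f ∈ γ.conv L (s * Nat.card F)) :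
    f ∈ γ.conv L s := by
  rw [mem_conv] at *
  have hq : Nat.card F ≠ 0 := Nat.card_pos.ne'
  have h1 := hf.rpow_const (p := (Nat.card F : ℝ)⁻¹) (Or.inr (by positivity))
  rw [Real.zero_rpow (by positivity)] at h1
  refine h1.congr fun k => ?_
  have h2 : spectralNorm K L (coeff k (γ.psSigma L f)) * ‖(γ.zeta : K)‖ ^ (s * Nat.card F * k) =
      (spectralNorm K L (coeff k f) * ‖(γ.zeta : K)‖ ^ (s * k)) ^ Nat.card F := by
    rw [mul_pow, ← Real.rpow_natCast (‖(γ.zeta : K)‖ ^ (s * k)), ← Real.rpow_mul (norm_nonneg _),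
      coeff_psSigma]
    congr 1
    · let _ := spectralNorm.normedField K L
      exact norm_pow (coeff k f) (Nat.card F)
    · congr 1; ring
  rw [h2, Real.pow_rpow_inv_natCast (mul_nonneg (spectralNorm_nonneg _)
    (Real.rpow_nonneg (norm_nonneg _) _)) hq]

variable {n : Type*} [Fintype n]

/-- Starting point of the iteration. Convergence of `Ψ` at `2` bounds its coefficients by a multiple
of `|ζ| ^ (-2k)`, a bound inherited by `y`; passing from `2` to `3` leaves a factor `|ζ| ^ k` that
tends to `0`. The values `2` and `3` have no significance beyond `1 < 2 < 3`. -/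
theorem mem_conv_three_of_frobenius_eq {Ψ : Matrix n n L⟦X⟧} {y : n → L⟦X⟧}
    (hy : ∀ i, γ.psSigma L (y i) = ∑ j, Ψ i j * y j) (hΨ : ∀ i j, Ψ i j ∈ γ.conv L 2) (i : n) :
    y i ∈ γ.conv L 3 := by
  let _ := spectralNorm.normedField K L
  have : IsUltrametricDist L :=
    IsUltrametricDist.isUltrametricDist_of_isNonarchimedean_norm isNonarchimedean_spectralNorm
  have hζ := γ.norm_zeta_pos
  set c := ‖(γ.zeta : K)‖ with hc
  have hb : ∀ i j, ∃ C, ∀ k, ‖coeff k (Ψ i j)‖ * c ^ ((2 : ℝ) * k) ≤ C := fun i j => by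
    obtain ⟨C, hC⟩ := ((γ.mem_conv).1 (hΨ i j)).bddAbove_range
    exact ⟨C, fun k => hC ⟨k, rfl⟩⟩
  choose C hC using hb
  obtain ⟨C', hC'⟩ := (Set.finite_range fun p : n × n => C p.1 p.2).bddAbove
  have hΨ' : ∀ i j k, ‖coeff k (Ψ i j)‖ ≤ max 1 C' * (c⁻¹ ^ 2) ^ k := by
    intro i j k
    have h1 : ‖coeff k (Ψ i j)‖ * c ^ ((2 : ℝ) * k) ≤ max 1 C' :=
      (hC i j k).trans ((hC' ⟨(i, j), rfl⟩).trans (le_max_right _ _))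
    rw [Real.rpow_mul hζ.le, Real.rpow_natCast, Real.rpow_ofNat] at h1
    rwa [inv_pow, inv_pow, ← div_eq_mul_inv, le_div_iff₀ (by positivity)]
  have hy' := norm_coeff_le_of_frobenius_eq (two_le_card F) (Ψ := Ψ) (y := y) (fun i k => by
    rw [← hy, coeff_psSigma]) (le_max_left 1 C')
    (one_le_pow₀ ((one_le_inv₀ hζ).2 γ.norm_zeta_lt.le)) hΨ' i
  rw [mem_conv]
  have h1 := (γ.tendsto_zeta_rpow one_pos).const_mul (max 1 C')
  rw [mul_zero] at h1
  refine squeeze_zero (fun k => mul_nonneg (spectralNorm_nonneg _)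
    (Real.rpow_nonneg (norm_nonneg _) _)) (fun k => ?_) h1
  refine (mul_le_mul_of_nonneg_right (hy' k) (Real.rpow_nonneg (norm_nonneg _) _)).trans_eq ?_
  rw [mul_assoc]
  congr 1
  rw [← hc, one_mul, Real.rpow_mul hζ.le, Real.rpow_natCast, Real.rpow_natCast, Real.rpow_ofNat]
  rw [← mul_pow]
  congr 1
  field_simp

/-- A solution of `σ̂(y) = Ψ y`, where `Ψ` converges for all exponents `s > 1`, converges for all
exponents `s > 1 / q̂`. -/
theorem mem_conv_of_frobenius_eq {Ψ : Matrix n n L⟦X⟧} {y : n → L⟦X⟧}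
    (hy : ∀ i, γ.psSigma L (y i) = ∑ j, Ψ i j * y j)
    (hΨ : ∀ s : ℝ, 1 < s → ∀ i j, Ψ i j ∈ γ.conv L s) {s : ℝ} (hs : 1 / (Nat.card F : ℝ) < s)
    (i : n) : y i ∈ γ.conv L s := by
  have hq : (1 : ℝ) < Nat.card F := by exact_mod_cast two_le_card F
  -- Convergence of `y` at `s` follows from that of `σ̂ y = Ψ y` at `s q̂`. Here `Ψ` requires `s q̂
  -- > 1`, which is the origin of the threshold `1/q̂`. After `k` steps the exponent has reached
  -- `3`.
  have key : ∀ (k : ℕ) (s : ℝ), 1 / (Nat.card F : ℝ) < s → 3 ≤ s * (Nat.card F : ℝ) ^ k →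
      ∀ i, y i ∈ γ.conv L s := by
    intro k
    induction k with
    | zero =>
      intro s _ h3 i
      exact γ.conv_mono (by simpa using h3)
        (γ.mem_conv_three_of_frobenius_eq hy (hΨ 2 one_lt_two) i)
    | succ k ih =>
      intro s hs h3 i
      refine γ.mem_conv_of_psSigma_mem ?_
      rw [hy]
      exact Subring.sum_mem _ fun j _ => Subring.mul_mem _ (hΨ _ (one_lt_exp_mul hs) i j)
        (ih _ (exp_mul hs) (by rw [mul_assoc, ← pow_succ']; exact h3) j)
  obtain ⟨k, hk⟩ := pow_unbounded_of_one_lt (3 / s) hq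
  exact key k s hs ((div_lt_iff₀' (exp_pos hs)).1 hk).le i

end

end CharMap

/-! ## Bases and semilinear maps -/

section Bases

variable {B C : Type*} [CommRing B] [CommRing C] {V W : Type*} [AddCommGroup V] [Module B V]
  [AddCommGroup W] [Module C W] {n : Type*} [Fintype n] {g : B →+* C}

theorem Module.Basis.repr_semilinear (b : Module.Basis n B V) (c : Module.Basis n C W)
    (φ : V →ₛₗ[g] W) (h : ∀ i, φ (b i) = c i) (x : V) (i : n) :
    c.repr (φ x) i = g (b.repr x i) := by
  classical
  conv_lhs => rw [← b.sum_repr x, map_sum, map_sum]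
  simp [LinearMap.map_smulₛₗ, h, Finsupp.single_apply]

theorem Module.Basis.semilinear_apply (b : Module.Basis n B V) (c : Module.Basis n C W)
    (φ : V →ₛₗ[g] W) (h : ∀ i, φ (b i) = c i) (x : V) :
    φ x = ∑ i, g (b.repr x i) • c i := by
  conv_lhs => rw [← b.sum_repr x, map_sum]
  simp only [LinearMap.map_smulₛₗ, h]

theorem Module.Basis.semilinear_sum (b : Module.Basis n B V) (c : Module.Basis n C W)
    (φ : V →ₛₗ[g] W) (h : ∀ i, φ (b i) = c i) (a : n → B) :
    φ (∑ i, a i • b i) = ∑ i, g (a i) • c i := by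
  rw [map_sum]
  simp only [LinearMap.map_smulₛₗ, h]

theorem Module.Basis.injective_of_semilinear (b : Module.Basis n B V) (c : Module.Basis n C W)
    (φ : V →ₛₗ[g] W) (h : ∀ i, φ (b i) = c i) (hg : Function.Injective g) :
    Function.Injective φ := by
  intro x y hxy
  refine b.ext_elem fun i => hg ?_
  rw [← b.repr_semilinear c φ h, ← b.repr_semilinear c φ h, hxy]

theorem Module.Basis.mem_range_semilinear (b : Module.Basis n B V) (c : Module.Basis n C W)
    (φ : V →ₛₗ[g] W) (h : ∀ i, φ (b i) = c i) (y : W) :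
    y ∈ Set.range φ ↔ ∀ i, c.repr y i ∈ Set.range g := by
  constructor
  · rintro ⟨x, rfl⟩ i
    exact ⟨_, (b.repr_semilinear c φ h x i).symm⟩
  · intro hy
    choose a ha using hy
    refine ⟨∑ i, a i • b i, ?_⟩
    rw [map_sum]
    simp only [LinearMap.map_smulₛₗ, h, ha]
    exact c.sum_repr y

theorem Module.Basis.semilinear_fixed_iff {σ : B →+* B} (b : Module.Basis n B V)
    (φ : V →ₛₗ[σ] V) (h : ∀ i, φ (b i) = b i) (x : V) :
    φ x = x ↔ ∀ i, σ (b.repr x i) = b.repr x i := by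
  constructor
  · intro hx i
    rw [← b.repr_semilinear b φ h, hx]
  · intro hx
    refine b.ext_elem fun i => ?_
    rw [b.repr_semilinear b φ h, hx]

theorem Module.Basis.exists_basis_of_isUnit [DecidableEq n] (b : Module.Basis n B V)
    {U : Matrix n n B} (hU : IsUnit U) :
    ∃ u : Module.Basis n B V, ∀ j, u j = ∑ i, U i j • b i := by
  refine ⟨b.map (Matrix.toLinearEquiv b U ((Matrix.isUnit_iff_isUnit_det U).1 hU)), fun j => ?_⟩
  rw [Module.Basis.map_apply]
  exact Matrix.toLin_self b b U j

/-- The new coordinate matrix is the image under `g` of the invertible change-of-basis matrix from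
`b` to `u`. -/
theorem Module.Basis.exists_basis_semilinear (b u : Module.Basis n B V) (c : Module.Basis n C W)
    (φ : V →ₛₗ[g] W) (h : ∀ i, φ (b i) = c i) :
    ∃ u' : Module.Basis n C W, ∀ j, u' j = φ (u j) := by
  classical
  have := b.invertibleToMatrix u
  have hU : IsUnit (g.mapMatrix (b.toMatrix u)) := (isUnit_of_invertible (b.toMatrix u)).map _
  obtain ⟨u', hu'⟩ := c.exists_basis_of_isUnit hU
  refine ⟨u', fun j => ?_⟩
  rw [hu', b.semilinear_apply c φ h]
  rfl

/-- Descent of a basis to a submodule over a smaller ring. -/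
theorem Module.Basis.exists_basis_submodule {A : Type*} [CommRing A] [Module A V] {ι : A →+* B}
    (hι : Function.Injective ι) (hsmul : ∀ (a : A) (x : V), a • x = ι a • x)
    (b : Module.Basis n B V) (T : Submodule A V)
    (hT : ∀ x, x ∈ T ↔ ∀ i, b.repr x i ∈ Set.range ι) :
    ∃ t : Module.Basis n A T, ∀ i, (t i : V) = b i := by
  classical
  have hb : ∀ i, b i ∈ T := fun i => (hT _).2 fun j => by
    rw [b.repr_self, Finsupp.single_apply]
    split_ifs
    · exact ⟨1, map_one _⟩
    · exact ⟨0, map_zero _⟩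
  have hli : LinearIndependent A (fun i => (⟨b i, hb i⟩ : T)) := by
    rw [Fintype.linearIndependent_iff]
    intro a ha i
    have h1 := congrArg (Subtype.val) ha
    rw [AddSubmonoidClass.coe_finsetSum] at h1
    simp only [Submodule.coe_smul, hsmul, Submodule.coe_zero] at h1
    exact hι ((Fintype.linearIndependent_iff.1 b.linearIndependent _ h1 i).trans (map_zero ι).symm)
  have hspan : ⊤ ≤ Submodule.span A (Set.range fun i => (⟨b i, hb i⟩ : T)) := by
    rintro ⟨x, hx⟩ -
    choose a ha using (hT x).1 hx
    have : (⟨x, hx⟩ : T) = ∑ i, a i • (⟨b i, hb i⟩ : T) := by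
      apply Subtype.ext
      rw [AddSubmonoidClass.coe_finsetSum]
      simp only [Submodule.coe_smul, hsmul, ha]
      exact (b.sum_repr x).symm
    rw [this]
    exact Submodule.sum_mem _ fun i _ => Submodule.smul_mem _ _ (Submodule.subset_span ⟨i, rfl⟩)
  exact ⟨Module.Basis.mk hli hspan, fun i => by rw [Module.Basis.mk_apply]⟩

end Bases

/-! ### Bases and composition of base changes -/

namespace BaseChange

variable {A B C : Type*} [CommRing A] [CommRing B] [CommRing C] {M : Type*} [AddCommGroup M]
  [Module A M]

/-- The basis of `M ⊗_{A,f} B` induced by a basis of `M`. -/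
noncomputable def basis (f : A →+* B) {n : Type*} (b : Module.Basis n A M) :
    Module.Basis n B (BaseChange f M) :=
  letI := f.toAlgebra
  (b.baseChange B : Module.Basis n B (TensorProduct A B M))

theorem basis_apply (f : A →+* B) {n : Type*} (b : Module.Basis n A M) (i : n) :
    basis f b i = of f (b i) := by
  let _ := f.toAlgebra
  exact Module.Basis.baseChange_apply B b i

theorem map_of {N : Type*} [AddCommGroup N] [Module A N] (f : A →+* B) (f' : A →+* C) (g : B →+* C)
    (hc : ∀ a, g (f a) = f' a) (u : M →ₗ[A] N) (m : M) :
    map f f' g hc u (of f m) = of f' (u m) := by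
  have h := map_smul_of f f' g hc u 1 m
  rwa [one_smul, map_one, one_smul] at h

theorem map_id_basis (f : A →+* B) (f' : A →+* C) (g : B →+* C) (hc : ∀ a, g (f a) = f' a)
    {n : Type*} (b : Module.Basis n A M) (i : n) :
    map f f' g hc LinearMap.id (basis f b i) = basis f' b i := by
  rw [basis_apply, basis_apply, map_of, LinearMap.id_apply]

theorem lift_of {N : Type*} [AddCommGroup N] [Module C N] (f : A →+* B) (g : B →+* C) (h : A →+* C)
    (hc : ∀ a, g (f a) = h a) (φ : M →ₛₗ[h] N) (m : M) : lift f g h hc φ (of f m) = φ m := by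
  have h := lift_smul_of f g h hc φ 1 m
  rwa [one_smul, map_one, one_smul] at h

theorem map_map {A B C D : Type*} [CommRing A] [CommRing B] [CommRing C] [CommRing D]
    {M N P : Type*} [AddCommGroup M] [Module A M] [AddCommGroup N] [Module A N] [AddCommGroup P]
    [Module A P] {f : A →+* B} {f' : A →+* C} {f'' : A →+* D} {g : B →+* C} {g' : C →+* D}
    (k : B →+* D) (hk : ∀ b, g' (g b) = k b) (hg : ∀ a, g (f a) = f' a)
    (hg' : ∀ a, g' (f' a) = f'' a) (hkf : ∀ a, k (f a) = f'' a) {u : M →ₗ[A] N} {u' : N →ₗ[A] P}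
    (w : M →ₗ[A] P) (hw : ∀ m, u' (u m) = w m) (y : BaseChange f M) :
    map f' f'' g' hg' u' (map f f' g hg u y) = map f f'' k hkf w y := by
  induction y using BaseChange.induction with
  | h0 => simp only [map_zero]
  | hof b m => rw [map_smul_of, map_smul_of, map_smul_of, hk, hw]
  | hadd x y hx hy => simp only [map_add, hx, hy]

/-- Common form of the squares relating change of coefficients to Galois actions, `id ⊗ σ̂` and
morphisms. -/
theorem map_map_comm {A B C C' D : Type*} [CommRing A] [CommRing B] [CommRing C]
    [CommRing C'] [CommRing D] {M N N' P : Type*} [AddCommGroup M] [Module A M] [AddCommGroup N]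
    [Module A N] [AddCommGroup N'] [Module A N'] [AddCommGroup P] [Module A P]
    {f : A →+* B} {f₁ : A →+* C} {f₂ : A →+* C'} {f' : A →+* D} {g : B →+* C} {g' : C →+* D}
    {k : B →+* C'} {k' : C' →+* D} (hgk : ∀ b, g' (g b) = k' (k b)) (hg : ∀ a, g (f a) = f₁ a)
    (hg' : ∀ a, g' (f₁ a) = f' a) (hk : ∀ a, k (f a) = f₂ a) (hk' : ∀ a, k' (f₂ a) = f' a)
    {u : M →ₗ[A] N} {u' : N →ₗ[A] P} {w : M →ₗ[A] N'} {w' : N' →ₗ[A] P}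
    (huw : ∀ m, u' (u m) = w' (w m)) (y : BaseChange f M) :
    map f₁ f' g' hg' u' (map f f₁ g hg u y) = map f₂ f' k' hk' w' (map f f₂ k hk w y) := by
  have hc : ∀ a, (k'.comp k) (f a) = f' a := fun a => by rw [RingHom.comp_apply, hk, hk']
  rw [map_map (k'.comp k) hgk hg hg' hc (w' ∘ₗ w) huw,
    map_map (k'.comp k) (fun _ => rfl) hk hk' hc (w' ∘ₗ w) (fun _ => rfl)]

end BaseChange

/-! ### The matrix of Frobenius and its naturality in the coefficients -/

namespace LocalShtuka

section Frobenius

variable {F : Type u} [Field F] [Finite F] {K : Type v} [NontriviallyNormedField K]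
  [IsUltrametricDist K] {γ : CharMap F K} (M : LocalShtuka.{u, v, w} γ)

/-- The matrix of `τ_M` with respect to a basis of `M`. -/
noncomputable def tauMatrix {n : Type*} [Fintype n] [DecidableEq n]
    (e : Module.Basis n (intRing K)⟦X⟧ M.carrier) : Matrix n n γ.Loc :=
  LinearMap.toMatrix (BaseChange.basis γ.toLoc (BaseChange.basis γ.sigma e))
    (BaseChange.basis γ.toLoc e) M.τ.toLinearMap

theorem isUnit_tauMatrix {n : Type*} [Fintype n] [DecidableEq n]
    (e : Module.Basis n (intRing K)⟦X⟧ M.carrier) : IsUnit (M.tauMatrix e) :=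
  (Matrix.isUnit_iff_isUnit_det _).2 (LinearEquiv.isUnit_det M.τ _ _)

variable {B B' C C' : Type*} [CommRing B] [CommRing B'] [CommRing C] [CommRing C']
  (j : (intRing K)⟦X⟧ →+* B) (j' : (intRing K)⟦X⟧ →+* B') (s : B →+* B')
  (hs : ∀ a, s (j a) = j' (γ.sigma a)) (hu : IsUnit (j' (X - PowerSeries.C γ.zeta)))
  (k : (intRing K)⟦X⟧ →+* C) (k' : (intRing K)⟦X⟧ →+* C') (t : C →+* C')
  (ht : ∀ a, t (k a) = k' (γ.sigma a)) (hv : IsUnit (k' (X - PowerSeries.C γ.zeta)))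

theorem frob_basis {n : Type*} [Fintype n] [DecidableEq n]
    (e : Module.Basis n (intRing K)⟦X⟧ M.carrier) (a : n) :
    M.frob j j' s hs hu (BaseChange.basis j e a) =
      ∑ i, IsLocalization.Away.lift (S := γ.Loc) (X - PowerSeries.C γ.zeta) hu
        (M.tauMatrix e i a) • BaseChange.basis j' e i := by
  have h1 : M.τ (BaseChange.of γ.toLoc (BaseChange.of γ.sigma (e a))) =
      ∑ i, M.tauMatrix e i a • BaseChange.basis γ.toLoc e i := by
    rw [← BaseChange.basis_apply, ← BaseChange.basis_apply]
    refine ((BaseChange.basis γ.toLoc e).sum_repr _).symm.trans ?_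
    simp only [tauMatrix, LinearMap.toMatrix_apply]
    rfl
  have h2 := M.frob_smul_of j j' s hs hu 1 (e a)
  rw [one_smul, map_one, one_smul] at h2
  rw [BaseChange.basis_apply, h2, h1, map_sum]
  refine Finset.sum_congr rfl fun i _ => ?_
  rw [LinearMap.map_smulₛₗ, fromLoc, BaseChange.map_id_basis]

/-- The two homomorphisms from `R[[z]][1/(z - ζ)]` to `C'` agree on `R[[z]]`, hence are equal. -/
theorem map_fromLoc (g : B' →+* C') (hg : ∀ a, g (j' a) = k' a) (m : BaseChange γ.toLoc M.carrier) :
    BaseChange.map j' k' g hg LinearMap.id (M.fromLoc j' hu m) = M.fromLoc k' hv m := by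
  have e : g.comp (IsLocalization.Away.lift (S := γ.Loc) (X - PowerSeries.C γ.zeta) hu) =
      IsLocalization.Away.lift (S := γ.Loc) (X - PowerSeries.C γ.zeta) hv := by
    apply IsLocalization.ringHom_ext (Submonoid.powers (X - PowerSeries.C γ.zeta))
    ext1 a
    simp only [RingHom.comp_apply, IsLocalization.Away.lift_eq, hg]
  induction m using BaseChange.induction with
  | h0 => simp
  | hof b m =>
    simp only [fromLoc, BaseChange.map_smul_of, LinearMap.id_apply, ← e, RingHom.comp_apply]
  | hadd x y hx hy => simp only [map_add, hx, hy]

/-- The Frobenius is natural in the coefficient rings. -/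
theorem frob_map_id (g : B →+* C) (hg : ∀ a, g (j a) = k a) (g' : B' →+* C')
    (hg' : ∀ a, g' (j' a) = k' a) (hc : ∀ b, t (g b) = g' (s b)) (m : BaseChange j M.carrier) :
    M.frob k k' t ht hv (BaseChange.map j k g hg LinearMap.id m) =
      BaseChange.map j' k' g' hg' LinearMap.id (M.frob j j' s hs hu m) := by
  induction m using BaseChange.induction with
  | h0 => simp
  | hof b m =>
    rw [BaseChange.map_smul_of, frob_smul_of, frob_smul_of, LinearMap.map_smulₛₗ,
      M.map_fromLoc j' hu k' hv g' hg', hc, LinearMap.id_apply]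
  | hadd x y hx hy => simp only [map_add, hx, hy]

end Frobenius

end LocalShtuka

/-! ## Fixed points of the Frobenius on coefficients -/

/-- `X ^ q̂ - X` has at most `q̂` roots, and the image of `F` already provides that many. -/
theorem exists_of_pow_card_eq {F L : Type*} [Field F] [Finite F] [Field L] (i : F →+* L) {a : L}
    (ha : a ^ Nat.card F = a) : a ∈ Set.range i := by
  classical
  let _ := Fintype.ofFinite F
  have h1 : 1 < Nat.card F := Finite.one_lt_card
  have hne := FiniteField.X_pow_card_sub_X_ne_zero L h1
  let S := (Finset.univ : Finset F).image i
  have hS : S ⊆ (Polynomial.X ^ Nat.card F - Polynomial.X : Polynomial L).roots.toFinset := by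
    intro y hy
    obtain ⟨c, -, rfl⟩ := Finset.mem_image.1 hy
    rw [Multiset.mem_toFinset, Polynomial.mem_roots hne]
    simp [← map_pow, Nat.card_eq_fintype_card, FiniteField.pow_card]
  have hcard : S.card = Nat.card F := by
    rw [Finset.card_image_of_injective _ i.injective, Finset.card_univ, Nat.card_eq_fintype_card]
  have hle : (Polynomial.X ^ Nat.card F - Polynomial.X : Polynomial L).roots.toFinset.card ≤
      S.card := by
    rw [hcard]
    refine (Multiset.toFinset_card_le _).trans ((Polynomial.card_roots' _).trans_eq ?_)
    exact FiniteField.X_pow_card_sub_X_natDegree_eq L h1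
  have ha' : a ∈ S := by
    rw [Finset.eq_of_subset_of_card_le hS hle, Multiset.mem_toFinset, Polynomial.mem_roots hne]
    rw [Polynomial.IsRoot.def, Polynomial.eval_sub, Polynomial.eval_pow, Polynomial.eval_X, ha,
      sub_self]
  obtain ⟨c, -, hc⟩ := Finset.mem_image.1 ha'
  exact ⟨c, hc⟩

theorem natCast_card_eq_zero_of_ringHom {F L : Type*} [Field F] [Finite F] [Ring L] (i : F →+* L) :
    (Nat.card F : L) = 0 := by
  let _ := Fintype.ofFinite F
  rw [← map_natCast i, Nat.card_eq_fintype_card, FiniteField.cast_card_eq_zero, map_zero]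

theorem PowerSeries.mem_range_map_iff {A B : Type*} [CommRing A] [CommRing B] (f : A →+* B)
    (b : B⟦X⟧) : b ∈ Set.range (PowerSeries.map f) ↔ ∀ k, coeff k b ∈ Set.range f := by
  constructor
  · rintro ⟨a, rfl⟩ k
    exact ⟨coeff k a, (coeff_map f k a).symm⟩
  · intro h
    choose a ha using h
    exact ⟨PowerSeries.mk a, by ext k; simp [ha]⟩

theorem Matrix.isUnit_subring {B : Type*} [CommRing B] {S : Subring B} {n : Type*} [Fintype n]
    [DecidableEq n] {U W : Matrix n n B} (hU : ∀ i j, U i j ∈ S) (hW : ∀ i j, W i j ∈ S)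
    (hUW : U * W = 1) (hWU : W * U = 1) :
    IsUnit (Matrix.of fun i j => (⟨U i j, hU i j⟩ : S)) := by
  have hinj : Function.Injective (fun P : Matrix n n S => P.map S.subtype) :=
    Matrix.map_injective Subtype.val_injective
  refine isUnit_iff_exists.2 ⟨Matrix.of fun i j => ⟨W i j, hW i j⟩, hinj ?_, hinj ?_⟩
  · dsimp only
    rw [Matrix.map_mul, Matrix.map_one _ (map_zero _) (map_one _)]
    exact hUW
  · dsimp only
    rw [Matrix.map_mul, Matrix.map_one _ (map_zero _) (map_one _)]
    exact hWU

/-! ### Frobenius invariants in `L[[z]]` and `L((z))`, and convergence of localized elements -/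

namespace CharMap

section

variable {F : Type u} [Field F] {K : Type v} [NontriviallyNormedField K]
  [IsUltrametricDist K] (γ : CharMap F K) (L : Type x) [Field L] [Algebra K L]

theorem psA_eq_map : γ.psA L = PowerSeries.map (γ.constExt L) := by
  ext a k
  simp [psA, psEmb, ofA, constExt]

theorem psA_injective : Function.Injective (γ.psA L) := by
  rw [psA_eq_map]
  intro a b h
  ext k
  have h1 := congrArg (coeff k) h
  rw [coeff_map, coeff_map] at h1
  exact (γ.constExt L).injective h1

theorem psSigma_eq_iff [Finite F] (a : L⟦X⟧) :
    γ.psSigma L a = a ↔ a ∈ Set.range (γ.psA L) := by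
  constructor
  · intro h
    rw [psA_eq_map, PowerSeries.mem_range_map_iff]
    intro k
    apply exists_of_pow_card_eq
    rw [← γ.coeff_psSigma, h]
  · rintro ⟨a, rfl⟩
    exact γ.psSigma_psA L a

theorem lsQ_algebraMap (a : F⟦X⟧) :
    γ.lsQ L (algebraMap F⟦X⟧ F⸨X⸩ a) = algebraMap L⟦X⟧ L⸨X⸩ (γ.psA L a) := by
  rw [lsQ, laurentMap_algebraMap, psA_eq_map]

theorem lsSigma_algebraMap [Finite F] (a : L⟦X⟧) :
    γ.lsSigma L (algebraMap L⟦X⟧ L⸨X⸩ a) = algebraMap L⟦X⟧ L⸨X⸩ (γ.psSigma L a) :=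
  laurentMap_algebraMap _ _

/-- Powers of `z` are `σ̂`-invariant, so clearing denominators reduces to the case of `L[[z]]`. -/
theorem lsSigma_eq_iff [Finite F] (a : L⸨X⸩) :
    γ.lsSigma L a = a ↔ a ∈ Set.range (γ.lsQ L) := by
  constructor
  · intro h
    obtain ⟨⟨b, ⟨_, n, rfl⟩⟩, hb⟩ := IsLocalization.surj (Submonoid.powers (X : L⟦X⟧)) a
    dsimp only at hb
    have hX : (algebraMap L⟦X⟧ L⸨X⸩ (X ^ n)) ≠ 0 := by
      rw [map_pow]
      refine pow_ne_zero _ ?_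
      exact ((IsLocalization.map_units L⸨X⸩
        (⟨X, Submonoid.mem_powers X⟩ : Submonoid.powers (X : L⟦X⟧)))).ne_zero
    have hσX : γ.psSigma L (X ^ n) = X ^ n := by simp [psSigma]
    have hinj : Function.Injective (algebraMap L⟦X⟧ L⸨X⸩) :=
      IsLocalization.injective L⸨X⸩ (M := Submonoid.powers (X : L⟦X⟧))
        (powers_le_nonZeroDivisors_of_noZeroDivisors PowerSeries.X_ne_zero)
    have hσb : γ.psSigma L b = b := by
      apply hinj
      rw [← lsSigma_algebraMap, ← hb, map_mul, h, lsSigma_algebraMap, hσX]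
    obtain ⟨c, rfl⟩ := (γ.psSigma_eq_iff L b).1 hσb
    refine ⟨algebraMap F⟦X⟧ F⸨X⸩ c * (algebraMap F⟦X⟧ F⸨X⸩ (X ^ n))⁻¹, ?_⟩
    have hpX : γ.psA L (X ^ n) = X ^ n := by simp [psA_eq_map]
    rw [map_mul, map_inv₀, lsQ_algebraMap, lsQ_algebraMap, hpX, ← hb, mul_inv_cancel_right₀ hX]
  · rintro ⟨a, rfl⟩
    exact γ.lsSigma_lsQ L a

/-- For `s > 1` the element `z - ζ` is already a unit in `L⟨z/ζ^s⟩`, so the map to `L[[z]]` factors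
through this ring. -/
theorem lift_mem_conv [CompleteSpace K] [Algebra.IsAlgebraic K L] (c : γ.Loc) {s : ℝ}
    (hs : 1 < s) :
    IsLocalization.Away.lift (S := γ.Loc) (X - PowerSeries.C γ.zeta) (γ.isUnit_psEmb L) c ∈
      γ.conv L s := by
  have e : (γ.conv L s).subtype.comp (IsLocalization.Away.lift (S := γ.Loc)
      (X - PowerSeries.C γ.zeta) (γ.isUnit_convEmb L (one_pos.trans hs) hs)) =
      IsLocalization.Away.lift (S := γ.Loc) (X - PowerSeries.C γ.zeta) (γ.isUnit_psEmb L) := by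
    apply IsLocalization.ringHom_ext (Submonoid.powers (X - PowerSeries.C γ.zeta))
    ext1 a
    simp only [RingHom.comp_apply, IsLocalization.Away.lift_eq]
    rfl
  rw [← e]
  exact Subtype.property _

end

end CharMap

/-! ## Bases of Frobenius-fixed vectors -/

namespace LocalShtuka

section

variable {F : Type u} [Field F] [Finite F] {K : Type v} [NontriviallyNormedField K]
  [IsUltrametricDist K] {γ : CharMap F K} (M : LocalShtuka.{u, v, w} γ)
  (L : Type x) [Field L] [Algebra K L]

/-- A basis of `M` indexed by its rank. -/
noncomputable def stdBasis : Module.Basis (Fin M.rank) (intRing K)⟦X⟧ M.carrier :=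
  Module.finBasis _ _

theorem cvToPs_basis [CompleteSpace K] [Algebra.IsAlgebraic K L] {s : ℝ} (hs : 0 < s)
    (i : Fin M.rank) : M.cvToPs L hs (BaseChange.basis (γ.convEmb L hs) M.stdBasis i) =
      BaseChange.basis (CharMap.psEmb L) M.stdBasis i :=
  BaseChange.map_id_basis _ _ _ _ _ _

variable [CompleteSpace K] [IsSepClosure K L]

/-- The matrix of `τ̂` on `M ⊗ L[[z]]`. -/
noncomputable def frobMatrix : Matrix (Fin M.rank) (Fin M.rank) L⟦X⟧ :=
  (IsLocalization.Away.lift (S := γ.Loc) (X - PowerSeries.C γ.zeta)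
    (γ.isUnit_psEmb L)).mapMatrix (M.tauMatrix M.stdBasis)

omit [CompleteSpace K] [IsSepClosure K L] in
theorem psFrob_basis (a : Fin M.rank) :
    M.psFrob L (BaseChange.basis (CharMap.psEmb L) M.stdBasis a) =
      ∑ i, M.frobMatrix L i a • BaseChange.basis (CharMap.psEmb L) M.stdBasis i :=
  M.frob_basis _ _ _ (γ.psSigma_psEmb L) (γ.isUnit_psEmb L) M.stdBasis a

omit [CompleteSpace K] [IsSepClosure K L] in
theorem isUnit_frobMatrix : IsUnit (M.frobMatrix L) :=
  (M.isUnit_tauMatrix M.stdBasis).map (RingHom.mapMatrix _)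

theorem frobMatrix_mem_conv {s : ℝ} (hs : 1 < s) (i j : Fin M.rank) :
    M.frobMatrix L i j ∈ γ.conv L s :=
  γ.lift_mem_conv L _ hs

/-- The matrix of `τ_M` has its inverse over `R[[z]][1/(z - ζ)]`, so the inverse converges wherever
the matrix does. -/
theorem exists_inv_frobMatrix : ∃ Ψ : Matrix (Fin M.rank) (Fin M.rank) L⟦X⟧,
    Ψ * M.frobMatrix L = 1 ∧ ∀ s : ℝ, 1 < s → ∀ i j, Ψ i j ∈ γ.conv L s := by
  obtain ⟨T', -, hT'⟩ := isUnit_iff_exists.1 (M.isUnit_tauMatrix M.stdBasis)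
  refine ⟨(IsLocalization.Away.lift (S := γ.Loc) (X - PowerSeries.C γ.zeta)
    (γ.isUnit_psEmb L)).mapMatrix T', ?_, fun s hs i j => γ.lift_mem_conv L _ hs⟩
  rw [frobMatrix, ← map_mul, hT', map_one]

/-- Both `U` and its inverse `W` satisfy linear Frobenius equations, `σ̂(U) = Ψ U` and `σ̂(W) = W
Φ`, whose coefficients converge for all `s > 1`. Convergence of `W` is needed for `U` to stay
invertible over the convergent rings. -/
theorem exists_fixed_matrix : ∃ U W : Matrix (Fin M.rank) (Fin M.rank) L⟦X⟧,
    U * W = 1 ∧ W * U = 1 ∧ M.frobMatrix L * U.map (γ.psSigma L) = U ∧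
    ∀ s : ℝ, 1 / (Nat.card F : ℝ) < s → ∀ i j, U i j ∈ γ.conv L s ∧ W i j ∈ γ.conv L s := by
  have : IsSepClosed L := IsSepClosure.sep_closed K
  obtain ⟨U, hU, hΦU⟩ := exists_isUnit_fixed_matrix (CharMap.two_le_card F)
    (natCast_card_eq_zero_of_ringHom (γ.constExt L)) (s := qFrob (γ.constExt L)) (fun _ => rfl)
    (M.isUnit_frobMatrix L)
  change M.frobMatrix L * U.map (γ.psSigma L) = U at hΦU
  obtain ⟨W, hUW, hWU⟩ := isUnit_iff_exists.1 hU
  obtain ⟨Ψ, hΨΦ, hΨ⟩ := M.exists_inv_frobMatrix L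
  have hσU : U.map (γ.psSigma L) = Ψ * U := by
    conv_rhs => rw [← hΦU, ← Matrix.mul_assoc, hΨΦ, Matrix.one_mul]
  have hσW : W.map (γ.psSigma L) = W * M.frobMatrix L := by
    have h1 : W.map (γ.psSigma L) * U.map (γ.psSigma L) = 1 := by
      rw [← Matrix.map_mul, hWU, Matrix.map_one _ (map_zero _) (map_one _)]
    calc W.map (γ.psSigma L) = W.map (γ.psSigma L) * (Ψ * U * (W * M.frobMatrix L)) := by
          rw [Matrix.mul_assoc, ← Matrix.mul_assoc U, hUW, Matrix.one_mul, hΨΦ, Matrix.mul_one]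
      _ = W * M.frobMatrix L := by rw [← Matrix.mul_assoc, ← hσU, h1, Matrix.one_mul]
  refine ⟨U, W, hUW, hWU, hΦU, fun s hs i j => ⟨?_, ?_⟩⟩
  · refine γ.mem_conv_of_frobenius_eq (Ψ := Ψ) (y := fun i => U i j) (fun i => ?_) hΨ hs i
    simpa [Matrix.mul_apply] using congrFun (congrFun hσU i) j
  -- The equation for `W` multiplies on the right, so its rows, not its columns, are the solution
  -- vectors, with the transposed matrix.
  · refine γ.mem_conv_of_frobenius_eq (Ψ := (M.frobMatrix L).transpose) (y := fun j => W i j)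
      (fun j => ?_) (fun s hs i j => M.frobMatrix_mem_conv L hs j i) hs j
    simpa [Matrix.mul_apply, mul_comm] using congrFun (congrFun hσW i) j

/-- `M ⊗ L[[z]]` has a basis of `τ̂`-invariant vectors, which are bases of `M ⊗ L⟨z/ζ^s⟩` for all
`s > 1 / q̂`. -/
theorem exists_basis_fixed : ∃ u : Module.Basis (Fin M.rank) L⟦X⟧ (M.ps L),
    (∀ i, M.psFrob L (u i) = u i) ∧
    ∀ (s : ℝ) (hs : 1 / (Nat.card F : ℝ) < s),
      ∃ uc : Module.Basis (Fin M.rank) (γ.conv L s) (M.cv L (CharMap.exp_pos hs)),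
        ∀ i, M.cvToPs L (CharMap.exp_pos hs) (uc i) = u i := by
  obtain ⟨U, W, hUW, hWU, hΦU, hconv⟩ := M.exists_fixed_matrix L
  obtain ⟨u, hu⟩ := (BaseChange.basis (CharMap.psEmb L) M.stdBasis).exists_basis_of_isUnit
    (isUnit_iff_exists.2 ⟨W, hUW, hWU⟩)
  refine ⟨u, fun j => ?_, fun s hs => ?_⟩
  · rw [hu, map_sum]
    simp only [LinearMap.map_smulₛₗ, psFrob_basis, Finset.smul_sum, smul_smul]
    rw [Finset.sum_comm]
    refine Finset.sum_congr rfl fun i _ => ?_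
    rw [← Finset.sum_smul]
    congr 1
    conv_rhs => rw [← hΦU, Matrix.mul_apply]
    simp only [Matrix.map_apply, mul_comm]
  · obtain ⟨uc, huc⟩ := (BaseChange.basis (γ.convEmb L (CharMap.exp_pos hs))
      M.stdBasis).exists_basis_of_isUnit (Matrix.isUnit_subring (fun i j => (hconv s hs i j).1)
        (fun i j => (hconv s hs i j).2) hUW hWU)
    refine ⟨uc, fun j => ?_⟩
    rw [huc, hu]
    exact Module.Basis.semilinear_sum _ _ _ (M.cvToPs_basis L (CharMap.exp_pos hs)) _

/-- A basis of `M ⊗ L[[z]]` consisting of `τ̂`-invariant vectors. -/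
noncomputable def fixedBasis : Module.Basis (Fin M.rank) L⟦X⟧ (M.ps L) :=
  (M.exists_basis_fixed L).choose

theorem psFrob_fixedBasis (i : Fin M.rank) : M.psFrob L (M.fixedBasis L i) = M.fixedBasis L i :=
  (M.exists_basis_fixed L).choose_spec.1 i

theorem exists_basis_cv (s : ℝ) (hs : 1 / (Nat.card F : ℝ) < s) :
    ∃ uc : Module.Basis (Fin M.rank) (γ.conv L s) (M.cv L (CharMap.exp_pos hs)),
      ∀ i, M.cvToPs L (CharMap.exp_pos hs) (uc i) = M.fixedBasis L i :=
  (M.exists_basis_fixed L).choose_spec.2 s hs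

/-- In an invariant basis, invariance of a vector means that its coordinates are `σ̂`-invariant,
hence in `A_ε`. -/
theorem exists_basis_tate : ∃ t : Module.Basis (Fin M.rank) F⟦X⟧ (M.tate L),
    ∀ i, (t i : M.ps L) = M.fixedBasis L i := by
  refine (M.fixedBasis L).exists_basis_submodule (γ.psA_injective L) (fun _ _ => rfl) _ fun x => ?_
  refine ((M.fixedBasis L).semilinear_fixed_iff (M.psFrob L) (M.psFrob_fixedBasis L) x).trans ?_
  simp only [γ.psSigma_eq_iff]

/-- An `A_ε`-basis of the Tate module. -/
noncomputable def tateBasis : Module.Basis (Fin M.rank) F⟦X⟧ (M.tate L) :=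
  (M.exists_basis_tate L).choose

theorem coe_tateBasis (i : Fin M.rank) : (M.tateBasis L i : M.ps L) = M.fixedBasis L i :=
  (M.exists_basis_tate L).choose_spec i

/-! ### The comparison isomorphism -/

omit [CompleteSpace K] [IsSepClosure K L] in
theorem comparison_smul_of (b : L⟦X⟧) (t : M.tate L) :
    M.comparison L (b • BaseChange.of (γ.psA L) t) = b • (t : M.ps L) :=
  BaseChange.lift_smul_of _ _ _ _ _ _ _

theorem comparison_basis (i : Fin M.rank) :
    M.comparison L (BaseChange.basis (γ.psA L) (M.tateBasis L) i) = M.fixedBasis L i := by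
  rw [BaseChange.basis_apply, ← coe_tateBasis]
  exact BaseChange.lift_of _ _ _ _ _ _

theorem comparison_bijective : Function.Bijective (M.comparison L) := by
  have e : M.comparison L = ((BaseChange.basis (γ.psA L) (M.tateBasis L)).equiv
      (M.fixedBasis L) (Equiv.refl _)).toLinearMap := by
    refine (BaseChange.basis (γ.psA L) (M.tateBasis L)).ext fun i => ?_
    rw [comparison_basis]
    simp
  rw [e]
  exact LinearEquiv.bijective _

end

section

variable {F : Type u} [Field F] [Finite F] {K : Type v} [NontriviallyNormedField K]
  [IsUltrametricDist K] {γ : CharMap F K} (M N : LocalShtuka.{u, v, w} γ)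
  (L : Type x) [Field L] [Algebra K L]

theorem comparison_tatePsGal (g : L ≃ₐ[K] L) (y : M.tatePs L) :
    M.comparison L (M.tatePsGal g y) = M.psGal g (M.comparison L y) := by
  induction y using BaseChange.induction with
  | h0 => simp only [map_zero]
  | hof b t =>
    rw [tatePsGal, BaseChange.map_smul_of, comparison_smul_of, comparison_smul_of,
      LinearMap.map_smulₛₗ]
    rfl
  | hadd x y hx hy => simp only [map_add, hx, hy]

theorem comparison_tatePsFrob (y : M.tatePs L) :
    M.comparison L (M.tatePsFrob L y) = M.psFrob L (M.comparison L y) := by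
  induction y using BaseChange.induction with
  | h0 => simp only [map_zero]
  | hof b t =>
    rw [tatePsFrob, BaseChange.map_smul_of, comparison_smul_of, comparison_smul_of,
      LinearMap.map_smulₛₗ, show M.psFrob L (t : M.ps L) = t from t.2]
    rfl
  | hadd x y hx hy => simp only [map_add, hx, hy]

variable {M N} in
theorem comparison_homTatePs (f : M.Hom N) (y : M.tatePs L) :
    N.comparison L (f.tatePs L y) = f.ps L (M.comparison L y) := by
  induction y using BaseChange.induction with
  | h0 => simp only [map_zero]
  | hof b t =>
    rw [Hom.tatePs, BaseChange.map_smul_of, comparison_smul_of, comparison_smul_of, map_smul]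
    rfl
  | hadd x y hx hy => simp only [map_add, hx, hy]

theorem psBase_basis (i : Fin M.rank) :
    M.psBase L (BaseChange.basis (CharMap.psEmb K) M.stdBasis i) =
      BaseChange.basis (CharMap.psEmb L) M.stdBasis i :=
  BaseChange.map_id_basis _ _ _ _ _ _

theorem psGal_basis (g : L ≃ₐ[K] L) (i : Fin M.rank) :
    M.psGal g (BaseChange.basis (CharMap.psEmb L) M.stdBasis i) =
      BaseChange.basis (CharMap.psEmb L) M.stdBasis i :=
  BaseChange.map_id_basis _ _ _ _ _ _

theorem psBase_injective : Function.Injective (M.psBase L) := by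
  refine (BaseChange.basis (CharMap.psEmb K) M.stdBasis).injective_of_semilinear
    (BaseChange.basis (CharMap.psEmb L) M.stdBasis) _ (M.psBase_basis L) ?_
  exact PowerSeries.map_injective _ (algebraMap K L).injective

/-- A basis coming from `M` is Galois-invariant, so the claim reduces to coefficients of
coordinates, where the fixed field of the Galois group is `K`. -/
theorem forall_psGal_eq_iff [IsGalois K L] (x : M.ps L) :
    (∀ g : L ≃ₐ[K] L, M.psGal g x = x) ↔ x ∈ Set.range (M.psBase L) := by
  rw [(BaseChange.basis (CharMap.psEmb K) M.stdBasis).mem_range_semilinear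
    (BaseChange.basis (CharMap.psEmb L) M.stdBasis) _ (M.psBase_basis L)]
  have h1 : ∀ g : L ≃ₐ[K] L, M.psGal g x = x ↔ ∀ i k,
      g (coeff k ((BaseChange.basis (CharMap.psEmb L) M.stdBasis).repr x i)) =
        coeff k ((BaseChange.basis (CharMap.psEmb L) M.stdBasis).repr x i) := by
    intro g
    rw [(BaseChange.basis (CharMap.psEmb L) M.stdBasis).semilinear_fixed_iff _ (M.psGal_basis L g)]
    refine forall_congr' fun i => ?_
    rw [PowerSeries.ext_iff]
    refine forall_congr' fun k => ?_
    rw [CharMap.psGal, coeff_map]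
    rfl
  simp only [h1, PowerSeries.mem_range_map_iff, InfiniteGalois.mem_range_algebraMap_iff_fixed]
  exact ⟨fun h i k g => h g i k, fun h g i k => h i k g⟩

theorem forall_tatePsGal_eq_iff [CompleteSpace K] [IsSepClosure K L] (y : M.tatePs L) :
    (∀ g : L ≃ₐ[K] L, M.tatePsGal g y = y) ↔ M.comparison L y ∈ Set.range (M.psBase L) := by
  have : IsGalois K L := IsSepClosure.isGalois (k := K) (K := L)
  rw [← forall_psGal_eq_iff]
  refine forall_congr' fun g => ?_
  rw [← comparison_tatePsGal, (M.comparison_bijective L).1.eq_iff]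

end

end LocalShtuka

/-! ## Continuity of the Galois actions -/

theorem LaurentSeries.exists_forall_X_pow_dvd_mem {F : Type*} [Field F] {s : Set F⸨X⸩}
    (hs : s ∈ 𝓝 (0 : F⸨X⸩)) :
    ∃ n : ℕ, ∀ f : F⟦X⟧, (X : F⟦X⟧) ^ n ∣ f → algebraMap F⟦X⟧ F⸨X⸩ f ∈ s := by
  obtain ⟨δ, hδ⟩ := Valued.mem_nhds_zero.1 hs
  simp_rw [Valued.v.restrict_lt_iff_lt_embedding] at hδ
  set d := MonoidWithZeroHom.ValueGroup₀.embedding δ.1 with hd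
  have hd0 : d ≠ 0 := by
    rw [hd]
    simp
  -- Divisibility by `X ^ n` gives valuation at most `exp (-n)`, and this is below `d` once `n >
  -- -log d`; the `+ 1` makes the inequality strict.
  refine ⟨(-WithZero.log d).toNat + 1, fun f hf => hδ ?_⟩
  have h1 := (LaurentSeries.intValuation_le_iff_coeff_lt_eq_zero F f).2 (PowerSeries.X_pow_dvd_iff.1 hf)
  refine lt_of_le_of_lt h1 ?_
  rw [← WithZero.lt_log_iff_exp_lt hd0]
  omega

/-- A family of endomorphisms whose matrix coefficients are continuous is jointly continuous for the
module topology. -/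
theorem Module.Basis.continuous_action {A G V n : Type*} [CommRing A] [TopologicalSpace A]
    [IsTopologicalRing A] [TopologicalSpace G] [AddCommGroup V] [Module A V] [Fintype n]
    (b : Module.Basis n A V) {P : n → n → G → A} (hP : ∀ i j, Continuous (P i j)) {f : G → V → V}
    (hf : ∀ g v, f g v = ∑ i, b.repr v i • ∑ j, P i j g • b j) :
    letI : TopologicalSpace V := moduleTopology A V
    Continuous fun p : G × V => f p.1 p.2 := by
  let _ : TopologicalSpace V := moduleTopology A V
  have : IsModuleTopology A V := ⟨rfl⟩
  have : ContinuousAdd V := IsModuleTopology.toContinuousAdd A V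
  have : ContinuousSMul A V := ModuleTopology.continuousSMul A V
  simp only [hf]
  refine continuous_finsetSum _ fun i _ => Continuous.smul ?_ ?_
  · exact (IsModuleTopology.continuous_of_linearMap (b.coord i)).comp continuous_snd
  · exact continuous_finsetSum _ fun j _ => ((hP i j).comp continuous_fst).smul continuous_const

namespace LocalShtuka

section

variable {F : Type u} [Field F] [Finite F] {K : Type v} [NontriviallyNormedField K]
  [IsUltrametricDist K] {γ : CharMap F K} (M : LocalShtuka.{u, v, w} γ)
  (L : Type x) [Field L] [Algebra K L]

/-- Since `z ^ n` is `σ̂`-invariant and cancels in the free module `M ⊗ L[[z]]`, the quotient `m` is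
again `τ̂`-invariant. Thus congruences modulo `z ^ n` may be tested in `M ⊗ L[[z]]`. -/
theorem exists_tate_eq_smul {t : M.tate L} {n : ℕ} {m : M.ps L}
    (h : (t : M.ps L) = (X : L⟦X⟧) ^ n • m) : ∃ t' : M.tate L, t = (X : F⟦X⟧) ^ n • t' := by
  have hX : γ.psA L (X ^ n) = X ^ n := by simp [CharMap.psA_eq_map]
  have hσX : γ.psSigma L (X ^ n) = X ^ n := by rw [← hX, CharMap.psSigma_psA]
  have ht : M.psFrob L (t : M.ps L) = t := t.2
  have hm : M.psFrob L m = m := by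
    rw [h, LinearMap.map_smulₛₗ, hσX] at ht
    refine (BaseChange.basis (CharMap.psEmb L) M.stdBasis).ext_elem fun i => ?_
    have h1 := congrArg
      (fun x => (BaseChange.basis (CharMap.psEmb L) M.stdBasis).repr x i) ht
    simp only [map_smul, Finsupp.smul_apply, smul_eq_mul] at h1
    exact mul_left_cancel₀ (pow_ne_zero n PowerSeries.X_ne_zero) h1
  refine ⟨⟨m, hm⟩, Subtype.ext ?_⟩
  change (t : M.ps L) = γ.psA L (X ^ n) • m
  rw [hX, h]

theorem exists_psGal_sub_eq_smul {g : L ≃ₐ[K] L} {m : M.ps L} {n : ℕ}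
    (hg : ∀ (i : Fin M.rank) (k : Fin n),
      g (coeff k ((BaseChange.basis (CharMap.psEmb L) M.stdBasis).repr m i)) =
        coeff k ((BaseChange.basis (CharMap.psEmb L) M.stdBasis).repr m i)) :
    ∃ m' : M.ps L, M.psGal g m - m = (X : L⟦X⟧) ^ n • m' := by
  set b := BaseChange.basis (CharMap.psEmb L) M.stdBasis
  have hdvd : ∀ i, (X : L⟦X⟧) ^ n ∣ CharMap.psGal g (b.repr m i) - b.repr m i := by
    intro i
    rw [PowerSeries.X_pow_dvd_iff]
    intro k hk
    rw [map_sub, CharMap.psGal, coeff_map, sub_eq_zero]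
    exact hg i ⟨k, hk⟩
  choose d hd using hdvd
  refine ⟨∑ i, d i • b i, b.ext_elem fun i => ?_⟩
  rw [map_sub, Finsupp.sub_apply, b.repr_semilinear b _ (M.psGal_basis L g), hd, map_smul,
    Finsupp.smul_apply, b.repr_sum_self, smul_eq_mul]

variable [CompleteSpace K] [IsSepClosure K L]

theorem eventually_tateRep_sub_eq_smul (n : ℕ) :
    ∀ᶠ g in 𝓝 (1 : L ≃ₐ[K] L), ∀ t : M.tate L, ∃ t' : M.tate L,
      M.tateRep L g t - t = (X : F⟦X⟧) ^ n • t' := by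
  have h1 : ∀ᶠ g in 𝓝 (1 : L ≃ₐ[K] L), ∀ (a i : Fin M.rank) (k : Fin n),
      g (coeff k ((BaseChange.basis (CharMap.psEmb L) M.stdBasis).repr (M.fixedBasis L a) i)) =
        coeff k ((BaseChange.basis (CharMap.psEmb L) M.stdBasis).repr (M.fixedBasis L a) i) := by
    simp only [eventually_all]
    intro a i k
    -- Only finitely many elements of `L` occur, and each has an open stabilizer because it is
    -- algebraic over `K`.
    exact (stabilizer_isOpen_of_isIntegral (K := K) (L := L) _).mem_nhds
      (one_mem (MulAction.stabilizer _ _))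
  filter_upwards [h1] with g hg
  have h2 : ∀ a, ∃ t' : M.tate L,
      M.tateRep L g (M.tateBasis L a) - M.tateBasis L a = (X : F⟦X⟧) ^ n • t' := by
    intro a
    obtain ⟨m, hm⟩ := M.exists_psGal_sub_eq_smul L (hg a)
    refine M.exists_tate_eq_smul L (m := m) ?_
    rw [← hm, ← coe_tateBasis]
    rfl
  choose t' ht' using h2
  intro t
  refine ⟨∑ a, (M.tateBasis L).repr t a • t' a, ?_⟩
  conv_lhs => rw [← (M.tateBasis L).sum_repr t]
  rw [map_sum, ← Finset.sum_sub_distrib, Finset.smul_sum]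
  refine Finset.sum_congr rfl fun a _ => ?_
  rw [map_smul]
  refine (smul_sub _ _ _).symm.trans ?_
  rw [ht']
  exact smul_comm _ _ _

theorem eventually_tateRep_sub_tateRep_eq_smul (g₀ : L ≃ₐ[K] L) (n : ℕ) :
    ∀ᶠ g in 𝓝 g₀, ∀ t : M.tate L, ∃ t' : M.tate L,
      M.tateRep L g t - M.tateRep L g₀ t = (X : F⟦X⟧) ^ n • t' := by
  have h1 : Tendsto (fun g => g₀⁻¹ * g) (𝓝 g₀) (𝓝 1) := by
    have := (continuous_const_mul g₀⁻¹).tendsto g₀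
    rwa [inv_mul_cancel] at this
  filter_upwards [h1.eventually (M.eventually_tateRep_sub_eq_smul L n)] with g hg t
  obtain ⟨t', ht'⟩ := hg t
  refine ⟨M.tateRep L g₀ t', ?_⟩
  rw [← map_smul, ← ht', map_sub, ← Module.End.mul_apply, ← map_mul, mul_inv_cancel_left]

theorem isContinuousIntegralRep_tateRep : IsContinuousIntegralRep (M.tateRep L) := by
  intro n
  rw [isOpen_iff_mem_nhds]
  intro g₀ hg₀
  filter_upwards [M.eventually_tateRep_sub_tateRep_eq_smul L g₀ n] with g hg t
  obtain ⟨t', ht'⟩ := hg t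
  obtain ⟨t'', ht''⟩ := hg₀ t
  exact ⟨t' + t'', by rw [smul_add, ← ht', ← ht'', sub_add_sub_cancel]⟩

/-- The coefficients of the matrix of `g` on the Tate module depend continuously on `g`. -/
theorem continuous_algebraMap_repr_tateRep (i j : Fin M.rank) :
    Continuous fun g : L ≃ₐ[K] L => algebraMap F⟦X⟧ F⸨X⸩
      ((M.tateBasis L).repr (M.tateRep L g (M.tateBasis L i)) j) := by
  rw [continuous_iff_continuousAt]
  intro g₀
  rw [ContinuousAt, ← tendsto_sub_nhds_zero_iff]
  intro s hs
  obtain ⟨n, hn⟩ := LaurentSeries.exists_forall_X_pow_dvd_mem hs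
  refine Filter.mem_map.2 ?_
  filter_upwards [M.eventually_tateRep_sub_tateRep_eq_smul L g₀ n] with g hg
  obtain ⟨t', ht'⟩ := hg (M.tateBasis L i)
  rw [Set.mem_preimage, ← map_sub, ← Finsupp.sub_apply, ← map_sub, ht', map_smul,
    Finsupp.smul_apply, smul_eq_mul]
  exact hn _ (dvd_mul_right _ _)

end

/-! ### The rational Tate module -/

section

variable {F : Type u} [Field F] [Finite F] {K : Type v} [NontriviallyNormedField K]
  [IsUltrametricDist K] {γ : CharMap F K} (M : LocalShtuka.{u, v, w} γ)
  (L : Type x) [Field L] [Algebra K L]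

/-- The canonical map `M ⊗ L[[z]] → M ⊗ L((z))`. -/
noncomputable def psToLs : M.ps L →ₛₗ[algebraMap L⟦X⟧ L⸨X⸩] M.ls L :=
  BaseChange.map (CharMap.psEmb L) (CharMap.lsEmb L) _ (fun _ => rfl) LinearMap.id

theorem psToLs_basis (i : Fin M.rank) :
    M.psToLs L (BaseChange.basis (CharMap.psEmb L) M.stdBasis i) =
      BaseChange.basis (CharMap.lsEmb L) M.stdBasis i :=
  BaseChange.map_id_basis _ _ _ _ _ _

theorem lsFrob_psToLs (m : M.ps L) : M.lsFrob L (M.psToLs L m) = M.psToLs L (M.psFrob L m) :=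
  M.frob_map_id (CharMap.psEmb L) (CharMap.psEmb L) (γ.psSigma L) (γ.psSigma_psEmb L)
    (γ.isUnit_psEmb L) (CharMap.lsEmb L) (CharMap.lsEmb L) (γ.lsSigma L) (γ.lsSigma_lsEmb L)
    (γ.isUnit_lsEmb L) (algebraMap L⟦X⟧ L⸨X⸩) (fun _ => rfl) (algebraMap L⟦X⟧ L⸨X⸩) (fun _ => rfl)
    (γ.lsSigma_algebraMap L) m

theorem lsGal_psToLs (g : L ≃ₐ[K] L) (m : M.ps L) :
    M.lsGal g (M.psToLs L m) = M.psToLs L (M.psGal g m) :=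
  BaseChange.map_map_comm (laurentMap_algebraMap (g : L →+* L)) _ _ _ _ (fun _ => rfl) m

variable [CompleteSpace K] [IsSepClosure K L]

/-- The `τ̂`-invariant basis of `M ⊗ L[[z]]` remains one over `L((z))`, and the descent argument of
the integral case applies with `Q_ε` in place of `A_ε`. -/
theorem exists_basis_rationalTate : ∃ t : Module.Basis (Fin M.rank) F⸨X⸩ (M.rationalTate L),
    ∀ i, (t i : M.ls L) = M.psToLs L (M.fixedBasis L i) := by
  obtain ⟨c, hc⟩ := (BaseChange.basis (CharMap.psEmb L) M.stdBasis).exists_basis_semilinear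
    (M.fixedBasis L) (BaseChange.basis (CharMap.lsEmb L) M.stdBasis) (M.psToLs L)
    (M.psToLs_basis L)
  have hfix : ∀ i, M.lsFrob L (c i) = c i := fun i => by
    rw [hc, lsFrob_psToLs, psFrob_fixedBasis]
  obtain ⟨t, ht⟩ := c.exists_basis_submodule (γ.lsQ L).injective (fun _ _ => rfl)
    (M.rationalTate L) (fun x => (c.semilinear_fixed_iff (M.lsFrob L) hfix x).trans
      (by simp only [γ.lsSigma_eq_iff]))
  exact ⟨t, fun i => (ht i).trans (hc i)⟩

/-- A `Q_ε`-basis of the rational Tate module. -/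
noncomputable def rationalTateBasis : Module.Basis (Fin M.rank) F⸨X⸩ (M.rationalTate L) :=
  (M.exists_basis_rationalTate L).choose

theorem coe_rationalTateBasis (i : Fin M.rank) :
    (M.rationalTateBasis L i : M.ls L) = M.psToLs L (M.fixedBasis L i) :=
  (M.exists_basis_rationalTate L).choose_spec i

/-- The integral and rational representations have the same matrices, so continuity passes from the
former to the latter. -/
theorem rationalTateRep_basis (g : L ≃ₐ[K] L) (i : Fin M.rank) :
    M.rationalTateRep L g (M.rationalTateBasis L i) =
      ∑ j, algebraMap F⟦X⟧ F⸨X⸩ ((M.tateBasis L).repr (M.tateRep L g (M.tateBasis L i)) j) •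
        M.rationalTateBasis L j := by
  apply Subtype.ext
  have h1 : M.psGal g (M.fixedBasis L i) =
      ∑ j, γ.psA L ((M.tateBasis L).repr (M.tateRep L g (M.tateBasis L i)) j) •
        M.fixedBasis L j := by
    have h2 := congrArg Subtype.val
      ((M.tateBasis L).sum_repr (M.tateRep L g (M.tateBasis L i))).symm
    rw [AddSubmonoidClass.coe_finsetSum] at h2
    simp only [Submodule.coe_smul, coe_tateBasis] at h2
    rw [← coe_tateBasis]
    exact h2
  rw [AddSubmonoidClass.coe_finsetSum]
  simp only [Submodule.coe_smul, coe_rationalTateBasis]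
  change M.lsGal g (M.rationalTateBasis L i : M.ls L) = _
  rw [coe_rationalTateBasis, lsGal_psToLs, h1, map_sum]
  refine Finset.sum_congr rfl fun j _ => ?_
  rw [LinearMap.map_smulₛₗ, ← γ.lsQ_algebraMap]
  rfl

theorem isContinuousRationalRep_rationalTateRep :
    IsContinuousRationalRep (M.rationalTateRep L) := by
  refine (M.rationalTateBasis L).continuous_action
    (f := fun g v => M.rationalTateRep L g v) (fun i j => M.continuous_algebraMap_repr_tateRep L i j) fun g v => ?_
  conv_lhs => rw [← (M.rationalTateBasis L).sum_repr v, map_sum]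
  simp only [map_smul, rationalTateRep_basis]

end

end LocalShtuka

/-! ## The comparison isomorphism over the rings of convergent power series -/

namespace LocalShtuka

section

variable {F : Type u} [Field F] [Finite F] {K : Type v} [NontriviallyNormedField K]
  [IsUltrametricDist K] [CompleteSpace K] {γ : CharMap F K} (M N : LocalShtuka.{u, v, w} γ)
  (L : Type x) [Field L] [Algebra K L] [Algebra.IsAlgebraic K L]

/-- This determines the isomorphisms `h_s` by the comparison over `L[[z]]`, so every identity
between them can be verified there. -/
theorem cvToPs_injective {s : ℝ} (hs : 0 < s) : Function.Injective (M.cvToPs L hs) :=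
  (BaseChange.basis (γ.convEmb L hs) M.stdBasis).injective_of_semilinear
    (BaseChange.basis (CharMap.psEmb L) M.stdBasis) _ (M.cvToPs_basis L hs) Subtype.val_injective

theorem cvToPs_cvIncl {s t : ℝ} (hs : 0 < s) (ht : 0 < t) (hst : s ≤ t) (y : M.cv L hs) :
    M.cvToPs L ht (M.cvIncl L hs ht hst y) = M.cvToPs L hs y :=
  BaseChange.map_map _ (fun _ => rfl) _ _ _ _ (fun _ => rfl) y

theorem tateCvToPs_tateCvIncl {s t : ℝ} (hs : 0 < s) (ht : 0 < t) (hst : s ≤ t)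
    (y : M.tateCv L hs) :
    M.tateCvToPs L ht (M.tateCvIncl L hs ht hst y) = M.tateCvToPs L hs y :=
  BaseChange.map_map _ (fun _ => rfl) _ _ _ _ (fun _ => rfl) y

theorem cvToPs_cvGal (g : L ≃ₐ[K] L) {s : ℝ} (hs : 0 < s) (y : M.cv L hs) :
    M.cvToPs L hs (M.cvGal g hs y) = M.psGal g (M.cvToPs L hs y) :=
  BaseChange.map_map_comm (by intro; rfl) _ _ _ _ (by intro; rfl) y

theorem tateCvToPs_tateCvGal (g : L ≃ₐ[K] L) {s : ℝ} (hs : 0 < s) (y : M.tateCv L hs) :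
    M.tateCvToPs L hs (M.tateCvGal g hs y) = M.tatePsGal g (M.tateCvToPs L hs y) :=
  BaseChange.map_map_comm (by intro; rfl) _ _ _ _ (by intro; rfl) y

theorem cvToPs_cvFrob {s : ℝ} (hs : 0 < s) (hs' : 0 < s * Nat.card F) (hs1 : 1 < s * Nat.card F)
    (y : M.cv L hs) :
    M.cvToPs L hs' (M.cvFrob L hs hs' hs1 y) = M.psFrob L (M.cvToPs L hs y) :=
  (M.frob_map_id _ _ _ (γ.convSigma_convEmb L hs hs') (γ.isUnit_convEmb L hs' hs1) _ _ _
    (γ.psSigma_psEmb L) (γ.isUnit_psEmb L) _ _ _ (fun _ => rfl) (fun _ => rfl) y).symm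

theorem tateCvToPs_tateCvFrob {s : ℝ} (hs : 0 < s) (hs' : 0 < s * Nat.card F)
    (y : M.tateCv L hs) :
    M.tateCvToPs L hs' (M.tateCvFrob L hs hs' y) = M.tatePsFrob L (M.tateCvToPs L hs y) :=
  BaseChange.map_map_comm (by intro; rfl) _ _ _ _ (by intro; rfl) y

variable {M N}

theorem cvToPs_homCv (f : M.Hom N) {s : ℝ} (hs : 0 < s) (y : M.cv L hs) :
    N.cvToPs L hs (f.cv L hs y) = f.ps L (M.cvToPs L hs y) :=
  BaseChange.map_map_comm (by intro; rfl) _ _ _ _ (by intro; rfl) y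

theorem tateCvToPs_homTateCv (f : M.Hom N) {s : ℝ} (hs : 0 < s) (y : M.tateCv L hs) :
    N.tateCvToPs L hs (f.tateCv L hs y) = f.tatePs L (M.tateCvToPs L hs y) :=
  BaseChange.map_map_comm (by intro; rfl) _ _ _ _ (by intro; rfl) y

end

section

variable {F : Type u} [Field F] [Finite F] {K : Type v} [NontriviallyNormedField K]
  [IsUltrametricDist K] [CompleteSpace K] {γ : CharMap F K} (M : LocalShtuka.{u, v, w} γ)
  (L : Type x) [Field L] [Algebra K L] [IsSepClosure K L]

theorem tateCvToPs_basis {s : ℝ} (hs : 0 < s) (i : Fin M.rank) :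
    M.tateCvToPs L hs (BaseChange.basis (γ.convA L hs) (M.tateBasis L) i) =
      BaseChange.basis (γ.psA L) (M.tateBasis L) i :=
  BaseChange.map_id_basis _ _ _ _ _ _

/-- The invariant basis of `M ⊗ L[[z]]` is also a basis over `L⟨z/ζ^s⟩`. Sending the Tate basis to
it is an isomorphism, and it agrees with the comparison map on basis vectors. -/
theorem exists_comparison_cv (s : ℝ) (hs : 1 / (Nat.card F : ℝ) < s) :
    ∃ h : M.tateCv L (CharMap.exp_pos hs) ≃ₗ[γ.conv L s] M.cv L (CharMap.exp_pos hs),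
      ∀ y, M.cvToPs L (CharMap.exp_pos hs) (h y) =
        M.comparison L (M.tateCvToPs L (CharMap.exp_pos hs) y) := by
  obtain ⟨uc, huc⟩ := M.exists_basis_cv L s hs
  let b := BaseChange.basis (γ.convA L (CharMap.exp_pos hs)) (M.tateBasis L)
  let h := b.equiv uc (Equiv.refl _)
  refine ⟨h, fun y => ?_⟩
  have h1 := b.semilinear_apply (M.fixedBasis L)
    ((M.cvToPs L (CharMap.exp_pos hs)).comp h.toLinearMap) (fun i => by
      rw [LinearMap.comp_apply, LinearEquiv.coe_coe, Module.Basis.equiv_apply, Equiv.refl_apply,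
        huc]) y
  have h2 := b.semilinear_apply (M.fixedBasis L)
    ((M.comparison L).comp (M.tateCvToPs L (CharMap.exp_pos hs))) (fun i => by
      rw [LinearMap.comp_apply, tateCvToPs_basis, comparison_basis]) y
  exact h1.trans h2.symm

end

end LocalShtuka

/-! ### The main theorem -/

theorem mainTheorem2 {F : Type u} [Field F] [Finite F]
    {K : Type v} [NontriviallyNormedField K] [IsUltrametricDist K] [CompleteSpace K]
    (γ : CharMap F K)
    (L : Type x) [Field L] [Algebra K L] [IsSepClosure K L] :
    -- the integral and the rational Tate module, the comparison isomorphism and Galois descent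
    (∀ M : LocalShtuka.{u, v, w} γ,
      Module.Free F⟦X⟧ (M.tate L) ∧ Module.Finite F⟦X⟧ (M.tate L) ∧
      Module.finrank F⟦X⟧ (M.tate L) = M.rank ∧
      IsContinuousIntegralRep (M.tateRep L) ∧
      Module.Finite F⸨X⸩ (M.rationalTate L) ∧
      Module.finrank F⸨X⸩ (M.rationalTate L) = M.rank ∧
      IsContinuousRationalRep (M.rationalTateRep L) ∧
      Function.Bijective (M.comparison L) ∧
      (∀ (g : L ≃ₐ[K] L) (y : M.tatePs L),
        M.comparison L (M.tatePsGal g y) = M.psGal g (M.comparison L y)) ∧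
      (∀ y : M.tatePs L, M.comparison L (M.tatePsFrob L y) = M.psFrob L (M.comparison L y)) ∧
      Function.Injective (M.psBase L) ∧
      (∀ y : M.tatePs L, (∀ g : L ≃ₐ[K] L, M.tatePsGal g y = y) ↔
        M.comparison L y ∈ Set.range (M.psBase L))) ∧
    -- functoriality of the comparison isomorphism
    (∀ (M N : LocalShtuka.{u, v, w} γ) (f : M.Hom N) (y : M.tatePs L),
      N.comparison L (f.tatePs L y) = f.ps L (M.comparison L y)) ∧
    -- the comparison isomorphism over the rings of convergent power series
    ∃ h : ∀ (M : LocalShtuka.{u, v, w} γ) (s : ℝ) (hs : 1 / (Nat.card F : ℝ) < s),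
        M.tateCv L (CharMap.exp_pos hs) ≃ₗ[γ.conv L s] M.cv L (CharMap.exp_pos hs),
      (∀ (M : LocalShtuka.{u, v, w} γ) s hs y, M.cvToPs L (CharMap.exp_pos hs) (h M s hs y) =
        M.comparison L (M.tateCvToPs L (CharMap.exp_pos hs) y)) ∧
      (∀ (M : LocalShtuka.{u, v, w} γ) s t hs ht (hst : s ≤ t) y,
        M.cvIncl L (CharMap.exp_pos hs) (CharMap.exp_pos ht) hst (h M s hs y) =
          h M t ht (M.tateCvIncl L (CharMap.exp_pos hs) (CharMap.exp_pos ht) hst y)) ∧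
      (∀ (M : LocalShtuka.{u, v, w} γ) s hs (g : L ≃ₐ[K] L) y,
        h M s hs (M.tateCvGal g (CharMap.exp_pos hs) y) =
          M.cvGal g (CharMap.exp_pos hs) (h M s hs y)) ∧
      (∀ (M : LocalShtuka.{u, v, w} γ) s hs y,
        h M (s * Nat.card F) (CharMap.exp_mul hs)
            (M.tateCvFrob L (CharMap.exp_pos hs) (CharMap.exp_pos (CharMap.exp_mul hs)) y) =
          M.cvFrob L (CharMap.exp_pos hs) (CharMap.exp_pos (CharMap.exp_mul hs))
            (CharMap.one_lt_exp_mul hs) (h M s hs y)) ∧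
      (∀ (M N : LocalShtuka.{u, v, w} γ) (f : M.Hom N) s hs y,
        h N s hs (f.tateCv L (CharMap.exp_pos hs) y) =
          f.cv L (CharMap.exp_pos hs) (h M s hs y)) := by

  refine ⟨fun M => ⟨.of_basis (M.tateBasis L), .of_basis (M.tateBasis L), ?_,
    M.isContinuousIntegralRep_tateRep L, .of_basis (M.rationalTateBasis L), ?_,
    M.isContinuousRationalRep_rationalTateRep L, M.comparison_bijective L,
    M.comparison_tatePsGal L, M.comparison_tatePsFrob L, M.psBase_injective L,
    M.forall_tatePsGal_eq_iff L⟩, fun M N f => LocalShtuka.comparison_homTatePs L f, ?_⟩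
  · rw [Module.finrank_eq_card_basis (M.tateBasis L), Fintype.card_fin]
  · rw [Module.finrank_eq_card_basis (M.rationalTateBasis L), Fintype.card_fin]
  · choose h hh using fun (M : LocalShtuka.{u, v, w} γ) s hs => M.exists_comparison_cv L s hs
    -- Each compatibility of `h` is checked after embedding into `M ⊗ L[[z]]`, where it becomes the
    -- one already known for the comparison map.
    refine ⟨h, hh, fun M s t hs ht hst y => ?_, fun M s hs g y => ?_, fun M s hs y => ?_,
      fun M N f s hs y => ?_⟩
    · apply M.cvToPs_injective L (CharMap.exp_pos ht)
      rw [M.cvToPs_cvIncl L, hh, hh, M.tateCvToPs_tateCvIncl L]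
    · apply M.cvToPs_injective L (CharMap.exp_pos hs)
      rw [hh, M.tateCvToPs_tateCvGal L, M.comparison_tatePsGal L, M.cvToPs_cvGal L, hh]
    · apply M.cvToPs_injective L (CharMap.exp_pos (CharMap.exp_mul hs))
      rw [hh, M.tateCvToPs_tateCvFrob L, M.comparison_tatePsFrob L, M.cvToPs_cvFrob L, hh]
    · apply N.cvToPs_injective L (CharMap.exp_pos hs)
      rw [hh, LocalShtuka.tateCvToPs_homTateCv L, LocalShtuka.comparison_homTatePs L,
        LocalShtuka.cvToPs_homCv L, hh]
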